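/- All posets are finite. A linear extension of a poset $P$ is a linear order $L$ on the ground set of $P$ such that $x<y$ in $P$ implies $x<y$ in $L$. The dimension $\dim(P)$ of a nonempty poset $P$ is the least positive integer $d$ for which there are linear extensions $L_1,\dots,L_d$ of $P$ such that $x<y$ in $P$ if and only if $x<y$ in $L_i$ for every $i=1,\dots,d$; the empty poset has dimension $0$. For $d\ge 2$, the standard example $S_d$ is the poset on the $2d$ points $a_1,\dots,a_d,b_1,\dots,b_d$ in which the only strict comparabilities are $a_i<b_j$ for $i\ne j$. A poset $P$ contains $S_d$ if some subposet of $P$ is isomorphic to $S_d$. **Theorem.** There is a function $f$ from the non-negative integers to the non-negative integers with $f(c)=O(c^2)$ as $c\to\infty$ such that the following holds for every positive integer $c$ and every integer $n>10f(c)$: if $P$ is a poset with $|P|\le 2n+1$ and $\dim(P)\ge n-c$, then $P$ contains a standard example $S_d$ for some $d\ge 2$ with $d\ge n-f(c)$. -/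

import Mathlib

open Filter Asymptotics

/-- The strict relation `r` is a linear extension of the poset `P`: it is a strict linear order
on the ground set of `P`, and `x < y` in `P` implies `r x y`. -/
structure IsLinearExtension (P : Type*) [PartialOrder P] (r : P → P → Prop) : Prop where
  isStrictTotalOrder : IsStrictTotalOrder P r
  extends_lt : ∀ x y : P, x < y → r x y

/-- A family of `d` linear extensions of `P` is a realizer of `P` if `x < y` in `P` exactly when
`x < y` in every member of the family. -/
structure IsRealizer (P : Type*) [PartialOrder P] {d : ℕ} (L : Fin d → P → P → Prop) : Prop where
  isLinearExtension : ∀ i, IsLinearExtension P (L i)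
  lt_iff : ∀ x y : P, x < y ↔ ∀ i, L i x y

/-- The dimension of a (finite) poset: the least size of a realizer. The empty family realizes
`P` only if `P` is empty, so for a nonempty poset this is the least *positive* `d` for which there
is a realizer of size `d`, and the empty poset has dimension `0`. -/
noncomputable def posetDim (P : Type*) [PartialOrder P] : ℕ :=
  sInf {d : ℕ | ∃ L : Fin d → P → P → Prop, IsRealizer P L}

/-- The ground set of the standard example `S_d`: the points `a_i` and `b_i`, for `i : Fin d`. -/
inductive StandardExample (d : ℕ) : Type
  | a (i : Fin d) : StandardExample d
  | b (i : Fin d) : StandardExample d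

namespace StandardExample

/-- The order of `S_d`: besides `x ≤ x`, the only relations are `a_i ≤ b_j` with `i ≠ j`. -/
inductive Le {d : ℕ} : StandardExample d → StandardExample d → Prop
  | refl (x : StandardExample d) : Le x x
  | a_le_b {i j : Fin d} (h : i ≠ j) : Le (a i) (b j)

instance (d : ℕ) : PartialOrder (StandardExample d) where
  le := Le
  le_refl := Le.refl
  le_trans x y z hxy hyz := by
    cases hxy with
    | refl => exact hyz
    | a_le_b h =>
      cases hyz with
      | refl => exact Le.a_le_b h
  le_antisymm x y hxy hyx := by
    cases hxy with
    | refl => rfl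
    | a_le_b h => cases hyx

end StandardExample

/-- The poset `P` contains the poset `Q` if some subposet of `P` is isomorphic to `Q`. -/
def ContainsPoset (P Q : Type*) [PartialOrder P] [PartialOrder Q] : Prop :=
  Nonempty (Q ↪o P)

/-!
# Posets of large dimension contain large standard examples

A poset on at most `2 * n + 1` points which has dimension at least `n - c` cannot be handled by
fewer than `n - O(c)` linear extensions, even after the deletion of `O(c)` points, since each
deleted point accounts for at most two linear extensions (`ResistsCovers`). Every step of the
argument produces a family of linear extensions that would be too small unless the poset has some
additional structure. The basic economy is that one linear extension can both raise `a` above everything that is not above `a` and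
lower `b` below everything that is not below `b` as soon as `a` is not below `b`; it can even raise
or lower a third point almost as far (`Covers.raise_lower_raise`, `Covers.raise_lower_lower`).

*Two antichains.* Dilworth's theorem gives an antichain of about `n` points, and antichains above
and below it which contain, up to `O(c)`, the remaining points
(`ResistsCovers.exists_threeLevels`). Hall's theorem matches the middle antichain with the other
two by incomparable pairs (`ResistsCovers.exists_threeLevels_matched`). If both outer antichains
were large, an upper and a lower point could share a linear extension
(`ThreeLevels.covers_combine`), so one of them has `O(c)` points. What is left is a pair of
antichains `x i` and `y i`, with no `y j` below an `x i`, and with `x i` and `y i` incomparable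
(`ResistsCovers.exists_incomparablePairs`).

*Arcs.* If `x i` lies below `y j` for all `i ≠ j` in a set of `d` indices, these indices span `S_d`.
An obstruction is an arc, a pair `i ≠ j` with `x i` not below `y j`. It suffices to show that
disjoint arcs number `O(c ^ 2)`: deleting the ends of a maximal family of disjoint arcs leaves a standard
example. For an arc `t = (i, j)` one linear extension raises `x i`, lowers `y j` and serves the pair
`x j, y i`, where two would normally be used. To profit from this for `k` arcs at once, the pairs
`x j, y i'` from different arcs have to be served as well, by the third task of linear extensions
which are used anyway for matched pairs among other points. By a greedy version of a random choice,
`80 * k ^ 2` arcs contain `k` for which that is possible (`exists_served_subset`): arcs are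
selected one at a time, each by averaging, and all conflicts between selected and still available
arcs are served at the cost of `75 * k` of the latter for each arc selected. With `k` a large multiple of `c` this
contradicts the lower bound for the dimension (`ResistsCovers.card_arcs_lt`).
-/

open scoped Classical

/-! ### Covering sets of pairs by linear extensions -/

/-- `Covers W q` means that at most `q` linear extensions of `P` suffice to put `x` above `y` in at
least one of them, for every ordered pair with `W x y`. -/
def Covers {P : Type*} [PartialOrder P] (W : P → P → Prop) (q : ℕ) : Prop :=
  ∃ l : List (P → P → Prop), l.length ≤ q ∧ (∀ r ∈ l, IsLinearExtension P r) ∧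
    ∀ x y, W x y → ∃ r ∈ l, r y x

section Covers

variable {P : Type*} [PartialOrder P]

/-- Ties of a monotone rank function can be broken by an arbitrary linear extension. -/
theorem exists_isLinearExtension_of_monotone {f : P → ℕ} (hf : Monotone f) :
    ∃ r : P → P → Prop, IsLinearExtension P r ∧ ∀ x y, f x < f y → r x y := by
  obtain ⟨s, hs, hle⟩ := extend_partialOrder ((· ≤ ·) : P → P → Prop)
  refine ⟨fun x y => f x < f y ∨ (f x = f y ∧ s x y ∧ x ≠ y), ⟨?_, ?_⟩, fun x y h => Or.inl h⟩
  · refine { trichotomous := ?_, irrefl := ?_, trans := ?_ }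
    · intro x y h1 h2
      by_contra hne
      push Not at h1 h2
      rcases hs.total x y with h | h
      · exact hne (h1.2 (le_antisymm h2.1 h1.1) h)
      · exact hne (h2.2 (le_antisymm h1.1 h2.1) h).symm
    · intro x h
      rcases h with h | h
      · exact lt_irrefl _ h
      · exact h.2.2 rfl
    · rintro x y z (h1 | ⟨h1, h2, h3⟩) (h4 | ⟨h4, h5, h6⟩)
      · exact Or.inl (h1.trans h4)
      · exact Or.inl (h4 ▸ h1)
      · exact Or.inl (h1 ▸ h4)
      · refine Or.inr ⟨h1.trans h4, hs.trans _ _ _ h2 h5, ?_⟩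
        rintro rfl
        exact h3 (hs.antisymm _ _ h2 h5)
  · intro x y h
    rcases (hf h.le).lt_or_eq with h' | h'
    · exact Or.inl h'
    · exact Or.inr ⟨h', hle _ _ h.le, h.ne⟩

theorem Covers.mono {W W' : P → P → Prop} {q q' : ℕ} (h : Covers W q)
    (hW : ∀ x y, W' x y → W x y) (hq : q ≤ q') : Covers W' q' := by
  obtain ⟨l, h1, h2, h3⟩ := h
  exact ⟨l, h1.trans hq, h2, fun x y hxy => h3 x y (hW x y hxy)⟩

theorem Covers.or {W W' : P → P → Prop} {q q' : ℕ} (h : Covers W q) (h' : Covers W' q') :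
    Covers (fun x y => W x y ∨ W' x y) (q + q') := by
  obtain ⟨l, h1, h2, h3⟩ := h
  obtain ⟨l', h1', h2', h3'⟩ := h'
  refine ⟨l ++ l', by simp; omega, ?_, ?_⟩
  · intro r hr
    rcases List.mem_append.1 hr with hr | hr
    exacts [h2 r hr, h2' r hr]
  · rintro x y (hxy | hxy)
    · obtain ⟨r, hr, h⟩ := h3 x y hxy
      exact ⟨r, List.mem_append.2 (Or.inl hr), h⟩
    · obtain ⟨r, hr, h⟩ := h3' x y hxy
      exact ⟨r, List.mem_append.2 (Or.inr hr), h⟩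

theorem Covers.of_false : Covers (fun _ _ : P => False) 0 :=
  ⟨[], by simp, by simp, by simp⟩

theorem Covers.biUnion {ι : Type*} (s : Finset ι) (W : ι → P → P → Prop)
    (h : ∀ i ∈ s, Covers (W i) 1) : Covers (fun x y => ∃ i ∈ s, W i x y) s.card := by
  induction s using Finset.induction_on with
  | empty => exact Covers.of_false.mono (by simp) le_rfl
  | insert a s ha ih =>
    refine ((h a (by simp)).or (ih fun i hi => h i (by simp [hi]))).mono ?_
      (by rw [Finset.card_insert_of_notMem ha]; omega)
    rintro x y ⟨i, hi, hxy⟩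
    rcases Finset.mem_insert.1 hi with rfl | hi
    · exact Or.inl hxy
    · exact Or.inr ⟨i, hi, hxy⟩

theorem Covers.of_monotone {f : P → ℕ} (hf : Monotone f) : Covers (fun x y => f y < f x) 1 := by
  obtain ⟨r, hr, h⟩ := exists_isLinearExtension_of_monotone hf
  exact ⟨[r], by simp, by simpa using hr, fun x y hxy => ⟨r, by simp, h y x hxy⟩⟩

/-- A family covering all incomparable pairs is a realizer, provided that it is not empty. -/
theorem Covers.posetDim_le {q : ℕ} (h : Covers (fun x y : P => ¬ x ≤ y) q) :
    posetDim P ≤ q + 1 := by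
  obtain ⟨l₁, hl₁, hr₁, hc₁⟩ := h
  obtain ⟨r₀, hr₀, -⟩ := exists_isLinearExtension_of_monotone (P := P) (monotone_const (c := 0))
  have hmem : (r₀ :: l₁).length ∈ {d : ℕ | ∃ L : Fin d → P → P → Prop, IsRealizer P L} := by
    refine ⟨fun i => (r₀ :: l₁).get i, ⟨?_, ?_⟩⟩
    · intro i
      have : (r₀ :: l₁).get i ∈ r₀ :: l₁ := List.get_mem _ _
      rcases List.mem_cons.1 this with h | h
      · rw [h]; exact hr₀
      · exact hr₁ _ h
    · intro x y
      constructor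
      · intro hxy i
        have : (r₀ :: l₁).get i ∈ r₀ :: l₁ := List.get_mem _ _
        rcases List.mem_cons.1 this with h | h
        · rw [h]; exact hr₀.extends_lt x y hxy
        · exact (hr₁ _ h).extends_lt x y hxy
      · intro hall
        by_contra hxy
        by_cases hle : x ≤ y
        · obtain rfl : x = y := hle.eq_of_not_lt hxy
          exact hr₀.isStrictTotalOrder.irrefl x (hall ⟨0, by simp⟩)
        · obtain ⟨r, hr, hyx⟩ := hc₁ x y hle
          obtain ⟨i, hi⟩ := List.mem_iff_get.1 (List.mem_cons_of_mem r₀ hr)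
          have := hall i
          simp only [hi] at this
          have hst := (hr₁ r hr).isStrictTotalOrder
          exact hst.irrefl x (hst.trans _ _ _ this hyx)
  have := Nat.sInf_le hmem
  simp only [List.length_cons] at this
  unfold posetDim
  omega

/-- Raise `a` above everything that is not above it. -/
theorem Covers.raise (a : P) : Covers (fun x y => x = a ∧ ¬ a ≤ y) 1 := by
  have hf : Monotone (fun z : P => if a ≤ z then 1 else 0) := by
    intro x y hxy
    dsimp only
    have h1 : a ≤ x → a ≤ y := fun h => h.trans hxy
    split_ifs <;> first | omega | (exfalso; tauto)
  refine (Covers.of_monotone hf).mono ?_ le_rfl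
  rintro x y ⟨rfl, h⟩
  simp [h]

/-- Lower `b` below everything that is not below it. -/
theorem Covers.lower (b : P) : Covers (fun x y => y = b ∧ ¬ x ≤ b) 1 := by
  have hf : Monotone (fun z : P => if z ≤ b then 0 else 1) := by
    intro x y hxy
    dsimp only
    have h1 : y ≤ b → x ≤ b := fun h => hxy.trans h
    split_ifs <;> first | omega | (exfalso; tauto)
  refine (Covers.of_monotone hf).mono ?_ le_rfl
  rintro x y ⟨rfl, h⟩
  simp [h]

/-- If `a ≰ b`, a single linear extension raises `a` and lowers `b`, both as far as possible; once
this is done it still raises `a'` above everything that is not above `a`. -/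
theorem Covers.raise_lower_raise {a a' b : P} (h : ¬ a ≤ b) (h' : ¬ a' ≤ b) :
    Covers (fun x y => (x = a ∧ ¬ a ≤ y) ∨ (y = b ∧ ¬ x ≤ b) ∨
      (x = a' ∧ ¬ a ≤ y ∧ ¬ a' ≤ y)) 1 := by
  have hf : Monotone (fun z : P => if a ≤ z then 3 else if a' ≤ z then 2 else
      if z ≤ b then 0 else 1) := by
    intro x y hxy
    have h1 : a ≤ x → a ≤ y := fun h => h.trans hxy
    have h2 : a' ≤ x → a' ≤ y := fun h => h.trans hxy
    have h3 : y ≤ b → x ≤ b := fun h => hxy.trans h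
    dsimp only
    split_ifs <;> first | omega | (exfalso; tauto)
  refine (Covers.of_monotone hf).mono ?_ le_rfl
  rintro x y (⟨rfl, hy⟩ | ⟨rfl, hy⟩ | ⟨rfl, hy, hy'⟩)
  · simp only [le_refl, hy, if_true, if_false]; split_ifs <;> omega
  · simp only [le_refl, h, h', hy, if_true, if_false]; split_ifs <;> omega
  · simp only [le_refl, hy, hy', if_true, if_false]; split_ifs <;> omega

theorem Covers.raise_lower {a b : P} (h : ¬ a ≤ b) :
    Covers (fun x y => (x = a ∧ ¬ a ≤ y) ∨ (y = b ∧ ¬ x ≤ b)) 1 :=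
  (Covers.raise_lower_raise h h).mono (fun x y hxy => by tauto) le_rfl

/-- If `a ≰ b`, a single linear extension raises `a` and lowers `b`, both as far as possible; once
this is done it still lowers `b'` below everything that is not below `b`. -/
theorem Covers.raise_lower_lower {a b b' : P} (h : ¬ a ≤ b) (h' : ¬ a ≤ b') :
    Covers (fun x y => (x = a ∧ ¬ a ≤ y) ∨ (y = b ∧ ¬ x ≤ b) ∨
      (y = b' ∧ ¬ x ≤ b ∧ ¬ x ≤ b')) 1 := by
  have hf : Monotone (fun z : P => if z ≤ b then 0 else if z ≤ b' then 1 else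
      if a ≤ z then 3 else 2) := by
    intro x y hxy
    have h1 : a ≤ x → a ≤ y := fun h => h.trans hxy
    have h2 : y ≤ b' → x ≤ b' := fun h => hxy.trans h
    have h3 : y ≤ b → x ≤ b := fun h => hxy.trans h
    dsimp only
    split_ifs <;> first | omega | (exfalso; tauto)
  refine (Covers.of_monotone hf).mono ?_ le_rfl
  rintro x y (⟨rfl, hy⟩ | ⟨rfl, hy⟩ | ⟨rfl, hy, hy'⟩)
  · simp only [le_refl, h, h', hy, if_true, if_false]; split_ifs <;> omega
  · simp only [le_refl, hy, if_true, if_false]; split_ifs <;> omega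
  · simp only [le_refl, hy, hy', if_true, if_false]; split_ifs <;> omega

/-- Two linear extensions suffice for the pairs inside an antichain: an antichain may be listed in
any order, in particular in some order and in its reverse. -/
theorem Covers.antichain {A : Finset P} (hA : IsAntichain (· ≤ ·) (A : Set P)) :
    Covers (fun x y => x ∈ A ∧ y ∈ A ∧ ¬ x ≤ y) 2 := by
  have key : ∀ g : P → ℕ, Covers (fun x y => x ∈ A ∧ y ∈ A ∧ g y < g x) 1 := by
    intro g
    have hf : Monotone (fun z : P => (A.filter (· ≤ z)).sup g) := by
      intro x y hxy
      refine Finset.sup_mono ?_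
      intro a ha
      simp only [Finset.mem_filter] at ha ⊢
      exact ⟨ha.1, ha.2.trans hxy⟩
    refine (Covers.of_monotone hf).mono ?_ le_rfl
    have hval : ∀ x ∈ A, (A.filter (· ≤ x)).sup g = g x := by
      intro x hx
      have : A.filter (· ≤ x) = {x} := by
        ext a
        simp only [Finset.mem_filter, Finset.mem_singleton]
        constructor
        · rintro ⟨ha, hle⟩
          exact hA.eq ha hx hle
        · rintro rfl
          exact ⟨hx, le_rfl⟩
      rw [this, Finset.sup_singleton]
    rintro x y ⟨hx, hy, h⟩
    simpa only [hval x hx, hval y hy] using h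
  let e : A ≃ Fin A.card := A.equivFin
  let g : P → ℕ := fun x => if h : x ∈ A then (e ⟨x, h⟩ : ℕ) else 0
  refine ((key g).or (key fun x => A.card - g x)).mono ?_ (by norm_num)
  rintro x y ⟨hx, hy, h⟩
  have hgx : g x < A.card := by simp only [g, hx, dif_pos]; exact (e ⟨x, hx⟩).2
  have hgy : g y < A.card := by simp only [g, hy, dif_pos]; exact (e ⟨y, hy⟩).2
  have hne : g x ≠ g y := by
    intro heq
    simp only [g, hx, hy, dif_pos] at heq
    have := e.injective (Fin.ext heq)
    simp only [Subtype.mk.injEq] at this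
    exact h this.le
  rcases lt_or_gt_of_ne hne with h | h
  · exact Or.inr ⟨hx, hy, by omega⟩
  · exact Or.inl ⟨hx, hy, h⟩

/-- One linear extension raises every element of `U` above every element of `Z`, provided no
element of `U` is below an element of `Z`. -/
theorem Covers.raise_set {U Z : Finset P} (h : ∀ u ∈ U, ∀ z ∈ Z, ¬ u ≤ z) :
    Covers (fun x y => x ∈ U ∧ y ∈ Z) 1 := by
  have hf : Monotone (fun z : P => if ∃ u ∈ U, u ≤ z then 1 else 0) := by
    intro x y hxy
    have : (∃ u ∈ U, u ≤ x) → ∃ u ∈ U, u ≤ y := fun ⟨u, hu, hx⟩ => ⟨u, hu, hx.trans hxy⟩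
    dsimp only
    split_ifs <;> first | omega | exact absurd (this ‹_›) ‹_›
  refine (Covers.of_monotone hf).mono ?_ le_rfl
  rintro x y ⟨hx, hy⟩
  have h1 : ∃ u ∈ U, u ≤ x := ⟨x, hx, le_rfl⟩
  have h2 : ¬ ∃ u ∈ U, u ≤ y := fun ⟨u, hu, huy⟩ => h u hu y hy huy
  simp [h1, h2]

/-- One linear extension lowers all elements of a chain. -/
theorem Covers.lower_chain {C : Finset P} (hC : ∀ x ∈ C, ∀ y ∈ C, x ≤ y ∨ y ≤ x) :
    Covers (fun x y => y ∈ C ∧ ¬ x ≤ y) 1 := by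
  have hf : Monotone (fun z : P => (C.filter (fun c => ¬ z ≤ c)).card) := by
    intro x y hxy
    refine Finset.card_le_card ?_
    intro c hc
    simp only [Finset.mem_filter] at hc ⊢
    exact ⟨hc.1, fun h => hc.2 (hxy.trans h)⟩
  refine (Covers.of_monotone hf).mono ?_ le_rfl
  rintro x y ⟨hy, h⟩
  refine Finset.card_lt_card (Finset.ssubset_iff_of_subset ?_ |>.2 ⟨y, ?_, ?_⟩)
  · intro c hc
    simp only [Finset.mem_filter] at hc ⊢
    refine ⟨hc.1, fun hxc => ?_⟩
    rcases hC c hc.1 y hy with h' | h'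
    · exact h (hxc.trans h')
    · exact hc.2 h'
  · simp [hy, h]
  · simp

/-- One linear extension raises all elements of a chain. -/
theorem Covers.raise_chain {C : Finset P} (hC : ∀ x ∈ C, ∀ y ∈ C, x ≤ y ∨ y ≤ x) :
    Covers (fun x y => x ∈ C ∧ ¬ x ≤ y) 1 := by
  have hf : Monotone (fun z : P => (C.filter (fun c => c ≤ z)).card) := by
    intro x y hxy
    refine Finset.card_le_card ?_
    intro c hc
    simp only [Finset.mem_filter] at hc ⊢
    exact ⟨hc.1, hc.2.trans hxy⟩
  refine (Covers.of_monotone hf).mono ?_ le_rfl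
  rintro x y ⟨hx, h⟩
  refine Finset.card_lt_card (Finset.ssubset_iff_of_subset ?_ |>.2 ⟨x, ?_, ?_⟩)
  · intro c hc
    simp only [Finset.mem_filter] at hc ⊢
    refine ⟨hc.1, ?_⟩
    rcases hC x hx c hc.1 with h' | h'
    · exact absurd (h'.trans hc.2) h
    · exact h'
  · simp [hx]
  · simp [h]

/-- Raising and lowering each element of `R` disposes of all pairs that meet `R`. -/
theorem Covers.raise_and_lower (R : Finset P) :
    Covers (fun x y => (x ∈ R ∨ y ∈ R) ∧ ¬ x ≤ y) (2 * R.card) := by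
  refine ((Covers.biUnion R _ fun a _ => Covers.raise a).or
    (Covers.biUnion R _ fun a _ => Covers.lower a)).mono ?_ (by omega)
  rintro x y ⟨h | h, hxy⟩
  · exact Or.inl ⟨x, h, rfl, hxy⟩
  · exact Or.inr ⟨y, h, rfl, hxy⟩

end Covers

/-! ### Matchings and Dilworth's theorem -/

/-- A finite set of pairs forming a matching: no two of them agree in a coordinate. -/
structure IsPairMatching {α β : Type*} (M : Finset (α × β)) : Prop where
  fst_inj : ∀ e ∈ M, ∀ e' ∈ M, e.1 = e'.1 → e = e'
  snd_inj : ∀ e ∈ M, ∀ e' ∈ M, e.2 = e'.2 → e = e'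

namespace IsPairMatching

variable {α β : Type*} {M : Finset (α × β)}

theorem card_image_fst (h : IsPairMatching M) : (M.image Prod.fst).card = M.card :=
  Finset.card_image_of_injOn fun e he e' he' => h.fst_inj e he e' he'

theorem card_image_snd (h : IsPairMatching M) : (M.image Prod.snd).card = M.card :=
  Finset.card_image_of_injOn fun e he e' he' => h.snd_inj e he e' he'

theorem subset (h : IsPairMatching M) {M' : Finset (α × β)} (hM : M' ⊆ M) : IsPairMatching M' :=
  ⟨fun e he e' he' => h.fst_inj e (hM he) e' (hM he'),
    fun e he e' he' => h.snd_inj e (hM he) e' (hM he')⟩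

theorem empty : IsPairMatching (∅ : Finset (α × β)) := ⟨by simp, by simp⟩

theorem insert (h : IsPairMatching M) {a : α} {b : β} (ha : ∀ e ∈ M, e.1 ≠ a)
    (hb : ∀ e ∈ M, e.2 ≠ b) : IsPairMatching (insert (a, b) M) := by
  constructor
  · intro e he e' he' heq
    rcases Finset.mem_insert.1 he with rfl | he <;> rcases Finset.mem_insert.1 he' with rfl | he'
    · rfl
    · exact absurd heq.symm (ha e' he')
    · exact absurd heq (ha e he)
    · exact h.fst_inj e he e' he' heq
  · intro e he e' he' heq
    rcases Finset.mem_insert.1 he with rfl | he <;> rcases Finset.mem_insert.1 he' with rfl | he'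
    · rfl
    · exact absurd heq.symm (hb e' he')
    · exact absurd heq (hb e he)
    · exact h.snd_inj e he e' he' heq

theorem union (h : IsPairMatching M) {M' : Finset (α × β)} (h' : IsPairMatching M')
    (h1 : ∀ e ∈ M, ∀ e' ∈ M', e.1 ≠ e'.1) (h2 : ∀ e ∈ M, ∀ e' ∈ M', e.2 ≠ e'.2) :
    IsPairMatching (M ∪ M') := by
  constructor
  · intro e he e' he' heq
    rcases Finset.mem_union.1 he with he | he <;> rcases Finset.mem_union.1 he' with he' | he'
    · exact h.fst_inj e he e' he' heq
    · exact absurd heq (h1 e he e' he')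
    · exact absurd heq.symm (h1 e' he' e he)
    · exact h'.fst_inj e he e' he' heq
  · intro e he e' he' heq
    rcases Finset.mem_union.1 he with he | he <;> rcases Finset.mem_union.1 he' with he' | he'
    · exact h.snd_inj e he e' he' heq
    · exact absurd heq (h2 e he e' he')
    · exact absurd heq.symm (h2 e' he' e he)
    · exact h'.snd_inj e he e' he' heq

end IsPairMatching

/-- Every matching `M₀` extends to a maximal matching in the relation `R` between `X` and `Y`. -/
theorem exists_maximal_matching {α β : Type*} (R : α → β → Prop) (X : Finset α) (Y : Finset β)
    (M₀ : Finset (α × β)) (h₀ : IsPairMatching M₀)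
    (hM₀ : ∀ e ∈ M₀, e.1 ∈ X ∧ e.2 ∈ Y ∧ R e.1 e.2) :
    ∃ M : Finset (α × β), M₀ ⊆ M ∧ IsPairMatching M ∧
      (∀ e ∈ M, e.1 ∈ X ∧ e.2 ∈ Y ∧ R e.1 e.2) ∧
      ∀ x ∈ X, ∀ y ∈ Y, (∀ e ∈ M, e.1 ≠ x) → (∀ e ∈ M, e.2 ≠ y) → ¬ R x y := by
  let F := (X ×ˢ Y).powerset.filter fun M => M₀ ⊆ M ∧ IsPairMatching M ∧ ∀ e ∈ M, R e.1 e.2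
  have hF : F.Nonempty := by
    refine ⟨M₀, Finset.mem_filter.2 ⟨Finset.mem_powerset.2 fun e he => ?_, subset_rfl, h₀,
      fun e he => (hM₀ e he).2.2⟩⟩
    exact Finset.mem_product.2 ⟨(hM₀ e he).1, (hM₀ e he).2.1⟩
  obtain ⟨M, hM, hmax⟩ := F.exists_max_image Finset.card hF
  obtain ⟨hM1, hM2, hM3, hM4⟩ := Finset.mem_filter.1 hM
  rw [Finset.mem_powerset] at hM1
  refine ⟨M, hM2, hM3, fun e he => ?_, fun x hx y hy h1 h2 hR => ?_⟩
  · have := Finset.mem_product.1 (hM1 he)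
    exact ⟨this.1, this.2, hM4 e he⟩
  · have hnew : insert (x, y) M ∈ F := by
      refine Finset.mem_filter.2 ⟨Finset.mem_powerset.2 ?_, hM2.trans (Finset.subset_insert _ _),
        hM3.insert h1 h2, ?_⟩
      · exact Finset.insert_subset (Finset.mem_product.2 ⟨hx, hy⟩) hM1
      · intro e he
        rcases Finset.mem_insert.1 he with rfl | he
        exacts [hR, hM4 e he]
    have hnot : (x, y) ∉ M := fun h => h1 _ h rfl
    have := hmax _ hnew
    rw [Finset.card_insert_of_notMem hnot] at this
    omega

/-- Either `R` contains a matching of size `s` between `X` and `Y`, or it becomes empty once fewer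
than `s` elements are deleted from each side. -/
theorem exists_matching_or_free {α β : Type*} (R : α → β → Prop) (X : Finset α) (Y : Finset β)
    (s : ℕ) :
    (∃ M : Finset (α × β), IsPairMatching M ∧ M.card = s ∧
      ∀ e ∈ M, e.1 ∈ X ∧ e.2 ∈ Y ∧ R e.1 e.2) ∨
    ∃ X' ⊆ X, ∃ Y' ⊆ Y, X.card ≤ X'.card + s ∧ Y.card ≤ Y'.card + s ∧
      ∀ x ∈ X', ∀ y ∈ Y', ¬ R x y := by
  obtain ⟨M, -, hM, hMR, hmax⟩ := exists_maximal_matching R X Y ∅ IsPairMatching.empty (by simp)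
  by_cases hs : s ≤ M.card
  · left
    obtain ⟨M', hM', hc⟩ := Finset.exists_subset_card_eq hs
    exact ⟨M', hM.subset hM', hc, fun e he => hMR e (hM' he)⟩
  · right
    refine ⟨X \ M.image Prod.fst, Finset.sdiff_subset, Y \ M.image Prod.snd, Finset.sdiff_subset,
      ?_, ?_, ?_⟩
    · have := Finset.le_card_sdiff (M.image Prod.fst) X
      rw [hM.card_image_fst] at this
      omega
    · have := Finset.le_card_sdiff (M.image Prod.snd) Y
      rw [hM.card_image_snd] at this
      omega
    · intro x hx y hy
      simp only [Finset.mem_sdiff, Finset.mem_image, not_exists, not_and] at hx hy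
      exact hmax x hx.1 y hy.1 hx.2 hy.2

/-- Hall's theorem with deficiency `δ`. -/
theorem exists_pairMatching_of_deficiency {ι α : Type*} (s : Finset ι) (N : ι → Finset α) (δ : ℕ)
    (h : ∀ T ⊆ s, T.card ≤ (T.biUnion N).card + δ) :
    ∃ M : Finset (ι × α), IsPairMatching M ∧ s.card ≤ M.card + δ ∧
      ∀ e ∈ M, e.1 ∈ s ∧ e.2 ∈ N e.1 := by
  -- Adding `δ` common neighbours reduces the claim to Hall's theorem.
  let t : s → Finset (α ⊕ Fin δ) := fun i => (N i).disjSum Finset.univ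
  have hall : ∀ T : Finset s, T.card ≤ (T.biUnion t).card := by
    intro T
    rcases T.eq_empty_or_nonempty with rfl | hT
    · simp
    have h1 : ((T.map (Function.Embedding.subtype _)).biUnion N).disjSum
        (Finset.univ : Finset (Fin δ)) ⊆ T.biUnion t := by
      intro x hx
      rcases x with x | x
      · simp only [Finset.inl_mem_disjSum, Finset.mem_biUnion, Finset.mem_map] at hx
        obtain ⟨-, ⟨i, hi, rfl⟩, hx⟩ := hx
        exact Finset.mem_biUnion.2 ⟨i, hi, by simpa [t] using hx⟩
      · obtain ⟨i, hi⟩ := hT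
        exact Finset.mem_biUnion.2 ⟨i, hi, by simp [t]⟩
    have h2 := Finset.card_le_card h1
    have h3 := h (T.map (Function.Embedding.subtype _)) (by
      intro x hx
      obtain ⟨i, -, rfl⟩ := Finset.mem_map.1 hx
      exact i.2)
    rw [Finset.card_disjSum, Finset.card_univ, Fintype.card_fin] at h2
    rw [Finset.card_map] at h3
    omega
  obtain ⟨g, hg, hgt⟩ := (Finset.all_card_le_biUnion_card_iff_exists_injective t).1 hall
  let M : Finset (ι × α) := (s ×ˢ s.biUnion N).filter
    fun e => ∃ h : e.1 ∈ s, g ⟨e.1, h⟩ = Sum.inl e.2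
  have hM : IsPairMatching M := by
    constructor
    · rintro ⟨i, a⟩ he ⟨i', a'⟩ he' rfl
      obtain ⟨-, h1, h2⟩ := Finset.mem_filter.1 he
      obtain ⟨-, h1', h2'⟩ := Finset.mem_filter.1 he'
      have := h2.symm.trans h2'
      simpa using this
    · rintro ⟨i, a⟩ he ⟨i', a'⟩ he' rfl
      obtain ⟨-, h1, h2⟩ := Finset.mem_filter.1 he
      obtain ⟨-, h1', h2'⟩ := Finset.mem_filter.1 he'
      have := hg (h2.trans h2'.symm)
      simpa using this
  refine ⟨M, hM, ?_, ?_⟩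
  · have hsub : (Finset.univ : Finset s).image g ⊆ (M.image Prod.snd).disjSum Finset.univ := by
      intro z hz
      obtain ⟨i, -, rfl⟩ := Finset.mem_image.1 hz
      rcases hz : g i with a | j
      · refine Finset.inl_mem_disjSum.2 (Finset.mem_image.2 ⟨(i, a), ?_, rfl⟩)
        refine Finset.mem_filter.2 ⟨Finset.mem_product.2 ⟨i.2, ?_⟩, i.2, hz⟩
        have := hgt i
        rw [hz] at this
        exact Finset.mem_biUnion.2 ⟨i, i.2, by simpa [t] using this⟩
      · simp
    have := Finset.card_le_card hsub
    rw [Finset.card_image_of_injective _ hg, Finset.card_disjSum, hM.card_image_snd] at this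
    simpa using this
  · rintro ⟨i, a⟩ he
    obtain ⟨h0, h1, h2⟩ := Finset.mem_filter.1 he
    refine ⟨h1, ?_⟩
    have := hgt ⟨i, h1⟩
    rw [h2] at this
    simpa [t] using this

section Dilworth

/-- If two distinct points with the same image under `f` can only be a fixed point and a preimage
of it, then points whose orbits merge lie on a common orbit. -/
theorem exists_iterate_eq_of_iterate_eq {α : Type*} {f : α → α}
    (hf : ∀ x y, f x = f y → x = y ∨ f x = x ∨ f y = y) (n : ℕ) :
    ∀ x y, f^[n] x = f^[n] y → (∃ k, f^[k] x = y) ∨ ∃ k, f^[k] y = x := by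
  have key : ∀ k x y, f^[k] x = f y → (∃ k, f^[k] x = y) ∨ ∃ k, f^[k] y = x := by
    intro k
    induction k with
    | zero => exact fun x y h => Or.inr ⟨1, h.symm⟩
    | succ k ih =>
      intro x y h
      have h' : f (f^[k] x) = f y := by rw [← h, Function.iterate_succ_apply']
      rcases hf _ _ h' with h1 | h1 | h1
      · exact Or.inl ⟨k, h1⟩
      · exact ih x y (h1.symm.trans h')
      · exact Or.inl ⟨k + 1, h.trans h1⟩
  induction n with
  | zero => exact fun x y h => Or.inl ⟨0, h⟩
  | succ n ih =>
    intro x y h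
    rcases ih (f x) (f y) h with ⟨k, hk⟩ | ⟨k, hk⟩
    · exact key (k + 1) x y hk
    · exact (key (k + 1) y x hk).symm

/-- Dilworth's theorem: some antichain of `S` is at least as large as the number of colour classes
of a colouring of `S` by chains. -/
theorem exists_antichain_chain_colouring {P : Type*} [PartialOrder P] (S : Finset P) :
    ∃ A ⊆ S, IsAntichain (· ≤ ·) (A : Set P) ∧ ∃ col : P → P, (S.image col).card ≤ A.card ∧
      ∀ x ∈ S, ∀ y ∈ S, col x = col y → x ≤ y ∨ y ≤ x := by
  obtain ⟨A, hA, hmax⟩ := (S.powerset.filter fun A : Finset P =>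
    IsAntichain (· ≤ ·) (A : Set P)).exists_max_image Finset.card ⟨∅, by simp⟩
  obtain ⟨hAS, hanti⟩ := Finset.mem_filter.1 hA
  rw [Finset.mem_powerset] at hAS
  -- A set exceeds its set of strict lower bounds by at most the antichain of its minimal elements.
  obtain ⟨M, hM, hcard, hMS⟩ := exists_pairMatching_of_deficiency S
    (fun x => S.filter (· < x)) A.card (by
      intro T hT
      have h1 : T \ T.biUnion (fun x => S.filter (· < x)) ∈ S.powerset.filter
          fun A : Finset P => IsAntichain (· ≤ ·) (A : Set P) := by
        refine Finset.mem_filter.2 ⟨Finset.mem_powerset.2 (Finset.sdiff_subset.trans hT), ?_⟩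
        intro x hx y hy hne hle
        have hx' := Finset.mem_sdiff.1 (Finset.mem_coe.1 hx)
        have hy' := Finset.mem_sdiff.1 (Finset.mem_coe.1 hy)
        exact hx'.2 (Finset.mem_biUnion.2 ⟨y, hy'.1,
          Finset.mem_filter.2 ⟨hT hx'.1, lt_of_le_of_ne hle hne⟩⟩)
      have h2 := hmax _ h1
      have h3 := Finset.le_card_sdiff (T.biUnion fun x => S.filter (· < x)) T
      omega)
  refine ⟨A, hAS, hanti, ?_⟩
  let f : P → P := fun x => if h : ∃ y, (x, y) ∈ M then h.choose else x
  have hf1 : ∀ x, (∃ y, (x, y) ∈ M) → (x, f x) ∈ M := by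
    intro x h
    simp only [f, h, dif_pos]
    exact h.choose_spec
  have hf2 : ∀ x, (¬ ∃ y, (x, y) ∈ M) → f x = x := by
    intro x h
    simp only [f, h, dif_neg, not_false_eq_true]
  have hlt : ∀ x, (∃ y, (x, y) ∈ M) → f x ∈ S ∧ f x < x := fun x h =>
    Finset.mem_filter.1 (hMS _ (hf1 x h)).2
  have hfle : ∀ x, f x ≤ x := by
    intro x
    by_cases h : ∃ y, (x, y) ∈ M
    · exact (hlt x h).2.le
    · exact (hf2 x h).le
  have hitle : ∀ k x, f^[k] x ≤ x := by
    intro k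
    induction k with
    | zero => exact fun x => le_rfl
    | succ k ih => exact fun x => (ih (f x)).trans (hfle x)
  have hinj : ∀ x y, f x = f y → x = y ∨ f x = x ∨ f y = y := by
    intro x y h
    by_cases hx : ∃ z, (x, z) ∈ M
    · by_cases hy : ∃ z, (y, z) ∈ M
      · have := hM.snd_inj _ (hf1 x hx) _ (hf1 y hy) h
        exact Or.inl (Prod.ext_iff.1 this).1
      · exact Or.inr (Or.inr (hf2 y hy))
    · exact Or.inr (Or.inl (hf2 x hx))
  have hroot : ∀ x, ∃ n, x ∈ S → f^[n] x ∈ S ∧ ¬ ∃ y, (f^[n] x, y) ∈ M := by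
    have : ∀ m, ∀ x, (S.filter (· < x)).card ≤ m →
        ∃ n, x ∈ S → f^[n] x ∈ S ∧ ¬ ∃ y, (f^[n] x, y) ∈ M := by
      intro m
      induction m with
      | zero =>
        intro x hx
        refine ⟨0, fun hxS => ⟨hxS, fun h => ?_⟩⟩
        have := hlt x h
        have h0 := Finset.card_eq_zero.1 (Nat.le_zero.1 hx)
        exact Finset.notMem_empty _ (h0 ▸ Finset.mem_filter.2 this)
      | succ m ih =>
        intro x hx
        by_cases h : ∃ y, (x, y) ∈ M
        · have hfx := hlt x h
          have : (S.filter (· < f x)).card < (S.filter (· < x)).card := by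
            refine Finset.card_lt_card (Finset.ssubset_iff_of_subset ?_ |>.2 ⟨f x, ?_, ?_⟩)
            · intro z hz
              simp only [Finset.mem_filter] at hz ⊢
              exact ⟨hz.1, hz.2.trans hfx.2⟩
            · exact Finset.mem_filter.2 hfx
            · simp
          obtain ⟨n, hn⟩ := ih (f x) (by omega)
          exact ⟨n + 1, fun _ => hn hfx.1⟩
        · exact ⟨0, fun hxS => ⟨hxS, h⟩⟩
    exact fun x => this _ x le_rfl
  choose n hn using hroot
  refine ⟨fun x => f^[n x] x, ?_, ?_⟩
  · have hsub : S.image (fun x => f^[n x] x) ⊆ S \ M.image Prod.fst := by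
      intro z hz
      obtain ⟨x, hx, rfl⟩ := Finset.mem_image.1 hz
      obtain ⟨h1, h2⟩ := hn x hx
      refine Finset.mem_sdiff.2 ⟨h1, fun h => h2 ?_⟩
      obtain ⟨⟨u, v⟩, he, heq⟩ := Finset.mem_image.1 h
      exact ⟨v, by rw [← heq]; exact he⟩
    have h1 := Finset.card_le_card hsub
    have h2 : M.image Prod.fst ⊆ S := by
      intro z hz
      obtain ⟨e, he, rfl⟩ := Finset.mem_image.1 hz
      exact (hMS e he).1
    have h3 := Finset.card_sdiff_add_card_eq_card h2
    rw [hM.card_image_fst] at h3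
    omega
  · intro x hx y hy heq
    have hfix : f (f^[n x] x) = f^[n x] x := hf2 _ (hn x hx).2
    have hfix' : f (f^[n y] y) = f^[n y] y := hf2 _ (hn y hy).2
    have h1 : f^[n x + n y] x = f^[n x + n y] y := by
      rw [Nat.add_comm, Function.iterate_add_apply, Function.iterate_fixed hfix,
        Nat.add_comm, Function.iterate_add_apply, Function.iterate_fixed hfix']
      exact heq
    rcases exists_iterate_eq_of_iterate_eq hinj _ x y h1 with ⟨k, rfl⟩ | ⟨k, rfl⟩
    · exact Or.inr (hitle k x)
    · exact Or.inl (hitle k y)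

variable {P : Type*} [PartialOrder P]

/-- By Dilworth's theorem, lowering all elements of `S` takes no more linear extensions than some
antichain of `S` has elements. -/
theorem Covers.exists_antichain_lower (S : Finset P) :
    ∃ A ⊆ S, IsAntichain (· ≤ ·) (A : Set P) ∧
      Covers (fun x y => y ∈ S ∧ ¬ x ≤ y) A.card := by
  obtain ⟨A, hAS, hA, col, hcard, hcol⟩ := exists_antichain_chain_colouring S
  refine ⟨A, hAS, hA, (Covers.biUnion (S.image col)
    (fun i x y => y ∈ S.filter (fun z => col z = i) ∧ ¬ x ≤ y)
    fun i _ => Covers.lower_chain ?_).mono ?_ hcard⟩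
  · intro x hx y hy
    simp only [Finset.mem_filter] at hx hy
    exact hcol x hx.1 y hy.1 (hx.2.trans hy.2.symm)
  · rintro x y ⟨hy, h⟩
    exact ⟨col y, Finset.mem_image_of_mem _ hy, Finset.mem_filter.2 ⟨hy, rfl⟩, h⟩

/-- The dual of `Covers.exists_antichain_lower`. -/
theorem Covers.exists_antichain_raise (S : Finset P) :
    ∃ A ⊆ S, IsAntichain (· ≤ ·) (A : Set P) ∧
      Covers (fun x y => x ∈ S ∧ ¬ x ≤ y) A.card := by
  obtain ⟨A, hAS, hA, col, hcard, hcol⟩ := exists_antichain_chain_colouring S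
  refine ⟨A, hAS, hA, (Covers.biUnion (S.image col)
    (fun i x y => x ∈ S.filter (fun z => col z = i) ∧ ¬ x ≤ y)
    fun i _ => Covers.raise_chain ?_).mono ?_ hcard⟩
  · intro x hx y hy
    simp only [Finset.mem_filter] at hx hy
    exact hcol x hx.1 y hy.1 (hx.2.trans hy.2.symm)
  · rintro x y ⟨hx, h⟩
    exact ⟨col x, Finset.mem_image_of_mem _ hx, Finset.mem_filter.2 ⟨hx, rfl⟩, h⟩

end Dilworth

/-! ### Reduction to three antichains -/

/-- Deleting `k` points lowers the dimension by at most `2 * k`; `ResistsCovers P n e` records this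
for a poset whose dimension is at least about `n - e`: any `q` linear extensions that take care of
all incomparable pairs inside `S` satisfy `n ≤ q + 2 * |Sᶜ| + e`. -/
def ResistsCovers (P : Type*) [PartialOrder P] [Fintype P] (n e : ℕ) : Prop :=
  ∀ (S : Finset P) (q : ℕ), Covers (fun x y => x ∈ S ∧ y ∈ S ∧ ¬ x ≤ y) q →
    n ≤ q + 2 * Sᶜ.card + e

/-- Three disjoint antichains, the lower one `D`, the middle one `A` and the upper one `U`, such
that no element lies below an element of a lower antichain. -/
structure ThreeLevels {P : Type*} [PartialOrder P] (A U D : Finset P) : Prop where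
  mid : IsAntichain (· ≤ ·) (A : Set P)
  up : IsAntichain (· ≤ ·) (U : Set P)
  down : IsAntichain (· ≤ ·) (D : Set P)
  up_mid : ∀ u ∈ U, ∀ a ∈ A, ¬ u ≤ a
  up_down : ∀ u ∈ U, ∀ d ∈ D, ¬ u ≤ d
  mid_down : ∀ a ∈ A, ∀ d ∈ D, ¬ a ≤ d

section ThreeLevels

variable {P : Type*} [PartialOrder P]

theorem resistsCovers_of_posetDim [Fintype P] {n c : ℕ} (h : (n : ℤ) - c ≤ posetDim P) :
    ResistsCovers P n (c + 1) := by
  intro S q hq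
  have := Covers.posetDim_le ((hq.or (Covers.raise_and_lower Sᶜ)).mono
    (W' := fun x y => ¬ x ≤ y) (by
      intro x y hxy
      by_cases hx : x ∈ S
      · by_cases hy : y ∈ S
        · exact Or.inl ⟨hx, hy, hxy⟩
        · exact Or.inr ⟨Or.inr (Finset.mem_compl.2 hy), hxy⟩
      · exact Or.inr ⟨Or.inl (Finset.mem_compl.2 hx), hxy⟩) le_rfl)
  omega

/-- With `A` an antichain, four linear extensions suffice for the pairs inside `A` and for those
that lead from a level to a lower one. -/
theorem Covers.levels {A U D : Finset P} (hA : IsAntichain (· ≤ ·) (A : Set P))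
    (hUA : ∀ u ∈ U, ∀ a ∈ A, ¬ u ≤ a) (hUD : ∀ u ∈ U, ∀ d ∈ D, ¬ u ≤ d)
    (hAD : ∀ a ∈ A, ∀ d ∈ D, ¬ a ≤ d) :
    Covers (fun x y => (x ∈ A ∨ x ∈ U) ∧ (y ∈ A ∨ y ∈ D) ∧ ¬ x ≤ y) 4 := by
  refine (((Covers.antichain hA).or (Covers.raise_set (U := U) (Z := A ∪ D) ?_)).or
    (Covers.raise_set hAD)).mono ?_ (by norm_num)
  · intro u hu z hz
    rcases Finset.mem_union.1 hz with hz | hz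
    exacts [hUA u hu z hz, hUD u hu z hz]
  · rintro x y ⟨hx | hx, hy | hy, h⟩
    · exact Or.inl (Or.inl ⟨hx, hy, h⟩)
    · exact Or.inr ⟨hx, hy⟩
    · exact Or.inl (Or.inr ⟨hx, Finset.mem_union_left _ hy⟩)
    · exact Or.inl (Or.inr ⟨hx, Finset.mem_union_right _ hy⟩)

namespace ThreeLevels

variable {A U D : Finset P}

theorem mono (h : ThreeLevels A U D) {A' U' D' : Finset P} (hA : A' ⊆ A) (hU : U' ⊆ U)
    (hD : D' ⊆ D) : ThreeLevels A' U' D' where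
  mid := h.mid.subset (Finset.coe_subset.2 hA)
  up := h.up.subset (Finset.coe_subset.2 hU)
  down := h.down.subset (Finset.coe_subset.2 hD)
  up_mid u hu a ha := h.up_mid u (hU hu) a (hA ha)
  up_down u hu d hd := h.up_down u (hU hu) d (hD hd)
  mid_down a ha d hd := h.mid_down a (hA ha) d (hD hd)

theorem disjoint_mid_up (h : ThreeLevels A U D) : Disjoint A U :=
  Finset.disjoint_left.2 fun x hx hx' => h.up_mid x hx' x hx le_rfl

theorem disjoint_mid_down (h : ThreeLevels A U D) : Disjoint A D :=
  Finset.disjoint_left.2 fun x hx hx' => h.mid_down x hx x hx' le_rfl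

theorem disjoint_up_down (h : ThreeLevels A U D) : Disjoint U D :=
  Finset.disjoint_left.2 fun x hx hx' => h.up_down x hx x hx' le_rfl

theorem card_union (h : ThreeLevels A U D) :
    (A ∪ (U ∪ D)).card = A.card + (U.card + D.card) := by
  rw [Finset.card_union_of_disjoint, Finset.card_union_of_disjoint h.disjoint_up_down]
  exact Finset.disjoint_union_right.2 ⟨h.disjoint_mid_up, h.disjoint_mid_down⟩

/-- Only pairs `x`, `y` with `x` in a level below that of `y` cost more than a bounded number of
linear extensions. -/
theorem covers (h : ThreeLevels A U D) {q : ℕ}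
    (h1 : Covers (fun x y => (x ∈ D ∧ y ∈ U ∧ ¬ x ≤ y) ∨ (x ∈ A ∧ y ∈ U ∧ ¬ x ≤ y) ∨
      (x ∈ D ∧ y ∈ A ∧ ¬ x ≤ y)) q) :
    Covers (fun x y => x ∈ A ∪ (U ∪ D) ∧ y ∈ A ∪ (U ∪ D) ∧ ¬ x ≤ y) (q + 8) := by
  refine (((h1.or (Covers.levels h.mid h.up_mid h.up_down h.mid_down)).or
    (Covers.antichain h.up)).or (Covers.antichain h.down)).mono ?_ (by omega)
  intro x y hxy
  simp only [Finset.mem_union] at hxy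
  tauto

end ThreeLevels

/-- If an antichain `N` has `r` elements, `r + 1` linear extensions suffice to raise and lower each
of them: going through `N` in some order, raise an element while lowering the next one. -/
theorem Covers.raise_and_lower_antichain {N : Finset P}
    (hN : IsAntichain (· ≤ ·) (N : Set P)) :
    Covers (fun x y => (x ∈ N ∨ y ∈ N) ∧ ¬ x ≤ y) (N.card + 1) := by
  have key : ∀ (N : Finset P) (b : P), b ∉ N →
      IsAntichain (· ≤ ·) ((insert b N : Finset P) : Set P) →
      Covers (fun x y => (x ∈ N ∨ y ∈ N ∨ y = b) ∧ ¬ x ≤ y) (N.card + 1) := by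
    intro N
    induction N using Finset.induction_on with
    | empty =>
      intro b _ _
      refine (Covers.lower b).mono ?_ (by simp)
      rintro x y ⟨hx | hx | rfl, h⟩
      · simp at hx
      · simp at hx
      · exact ⟨rfl, h⟩
    | insert a N ha ih =>
      intro b hb hanti
      have hab : ¬ a ≤ b := by
        intro hle
        have := hanti.eq (by simp) (by simp) hle
        exact hb (by simp [this])
      refine ((ih a ha (hanti.subset (by simp))).or (Covers.raise_lower hab)).mono ?_
        (by rw [Finset.card_insert_of_notMem ha])
      rintro x y ⟨hx, h⟩
      simp only [Finset.mem_insert] at hx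
      rcases hx with (rfl | hx) | (rfl | hx) | rfl
      · exact Or.inr (Or.inl ⟨rfl, h⟩)
      · exact Or.inl ⟨Or.inl hx, h⟩
      · exact Or.inl ⟨Or.inr (Or.inr rfl), h⟩
      · exact Or.inl ⟨Or.inr (Or.inl hx), h⟩
      · exact Or.inr (Or.inr ⟨rfl, h⟩)
  rcases N.eq_empty_or_nonempty with rfl | ⟨b, hb⟩
  · exact Covers.of_false.mono (by simp) (by simp)
  · have hins : insert b (N.erase b) = N := Finset.insert_erase hb
    refine ((key (N.erase b) b (by simp) (by rw [hins]; exact hN)).or (Covers.raise b)).mono ?_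
      (by rw [Finset.card_erase_add_one hb])
    rintro x y ⟨hx, h⟩
    by_cases hxb : x = b
    · exact Or.inr ⟨hxb, hxb ▸ h⟩
    · refine Or.inl ⟨?_, h⟩
      simp only [Finset.mem_erase]
      tauto

variable [Fintype P] {n e : ℕ}

/-- A poset on at most `2 * n + 1` points of dimension about `n` is, up to a few points, the union
of three antichains: a maximum antichain, whose size is at least about `n` by Dilworth's theorem,
and antichains above and below it, which together have at least about `n` points because chains
above are lowered by one linear extension each and chains below raised. -/
theorem ResistsCovers.exists_threeLevels (h : ResistsCovers P n e)
    (hcard : Fintype.card P ≤ 2 * n + 1) :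
    ∃ A U D : Finset P, ThreeLevels A U D ∧ n ≤ A.card + e ∧
      (A ∪ (U ∪ D))ᶜ.card ≤ 2 * e + 5 := by
  obtain ⟨A₀, -, hA₀, hcov⟩ := Covers.exists_antichain_lower (Finset.univ : Finset P)
  have hn₀ := h Finset.univ _ (hcov.mono (W' := fun x y => x ∈ Finset.univ ∧ y ∈ Finset.univ ∧
    ¬ x ≤ y) (fun x y hxy => hxy.2) le_rfl)
  simp only [Finset.compl_univ, Finset.card_empty, mul_zero, add_zero] at hn₀
  obtain ⟨A, hA, hmax⟩ := ((Finset.univ : Finset (Finset P)).filter fun A : Finset P =>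
    IsAntichain (· ≤ ·) (A : Set P)).exists_max_image Finset.card ⟨∅, by simp⟩
  replace hA : IsAntichain (· ≤ ·) (A : Set P) := (Finset.mem_filter.1 hA).2
  have hn : n ≤ A.card + e := by
    have := hmax A₀ (Finset.mem_filter.2 ⟨Finset.mem_univ _, hA₀⟩)
    omega
  let U := Finset.univ.filter fun x => ∃ a ∈ A, a < x
  let D := Finset.univ.filter fun x => ∃ a ∈ A, x < a
  have hcase : ∀ x, x ∈ A ∨ x ∈ U ∨ x ∈ D := by
    intro x
    by_contra hx
    simp only [not_or, U, D, Finset.mem_filter, Finset.mem_univ, true_and, not_exists,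
      not_and] at hx
    obtain ⟨hxA, hx1, hx2⟩ := hx
    have hne : ∀ a ∈ A, a ≠ x := fun a ha hax => hxA (hax ▸ ha)
    have : IsAntichain (· ≤ ·) ((insert x A : Finset P) : Set P) := by
      rw [Finset.coe_insert]
      refine hA.insert (fun a ha hxa hle => ?_) (fun a ha hxa hle => ?_)
      · exact hx1 a ha (lt_of_le_of_ne hle (hne a ha))
      · exact hx2 a ha (lt_of_le_of_ne hle (hne a ha).symm)
    have := hmax _ (Finset.mem_filter.2 ⟨Finset.mem_univ _, this⟩)
    rw [Finset.card_insert_of_notMem hxA] at this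
    omega
  have hUA : ∀ u ∈ U, ∀ a ∈ A, ¬ u ≤ a := by
    intro u hu a ha hle
    obtain ⟨a', ha', hlt⟩ := (Finset.mem_filter.1 hu).2
    have := hA.eq ha' ha (hlt.le.trans hle)
    exact absurd (hlt.trans_le hle) (by simp [this])
  have hAD : ∀ a ∈ A, ∀ d ∈ D, ¬ a ≤ d := by
    intro a ha d hd hle
    obtain ⟨a', ha', hlt⟩ := (Finset.mem_filter.1 hd).2
    have := hA.eq ha ha' (hle.trans hlt.le)
    exact absurd (hle.trans_lt hlt) (by simp [this])
  have hUD : ∀ u ∈ U, ∀ d ∈ D, ¬ u ≤ d := by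
    intro u hu d hd hle
    obtain ⟨a, ha, hlt⟩ := (Finset.mem_filter.1 hu).2
    exact hAD a ha d hd (hlt.le.trans hle)
  obtain ⟨U', hU', hU'A, hcU⟩ := Covers.exists_antichain_lower U
  obtain ⟨D', hD', hD'A, hcD⟩ := Covers.exists_antichain_raise D
  have hq := h Finset.univ _ (((hcU.or hcD).or (Covers.levels hA hUA hUD hAD)).mono
    (W' := fun x y => x ∈ Finset.univ ∧ y ∈ Finset.univ ∧ ¬ x ≤ y) (by
      rintro x y ⟨-, -, hxy⟩
      have hx := hcase x
      have hy := hcase y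
      tauto) le_rfl)
  simp only [Finset.compl_univ, Finset.card_empty, mul_zero, add_zero] at hq
  have hT : ThreeLevels A U' D' :=
    ⟨hA, hU'A, hD'A, fun u hu => hUA u (hU' hu), fun u hu d hd => hUD u (hU' hu) d (hD' hd),
      fun a ha d hd => hAD a ha d (hD' hd)⟩
  refine ⟨A, U', D', hT, hn, ?_⟩
  rw [Finset.card_compl, hT.card_union]
  omega

/-- Up to a few more points, the lower antichain lies below the upper one: an incomparable pair
`d, u` allows a single linear extension to raise `d` and lower `u`. -/
theorem ResistsCovers.exists_threeLevels_down_le_up (h : ResistsCovers P n e)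
    (hcard : Fintype.card P ≤ 2 * n + 1) :
    ∃ A U D : Finset P, ThreeLevels A U D ∧ n ≤ A.card + e ∧ (∀ d ∈ D, ∀ u ∈ U, d ≤ u) ∧
      (A ∪ (U ∪ D))ᶜ.card ≤ 14 * e + 35 := by
  obtain ⟨A, U, D, hT, hn, hρ⟩ := h.exists_threeLevels hcard
  obtain ⟨M, -, hM, hMR, hmax⟩ := exists_maximal_matching (fun d u => ¬ d ≤ u) D U ∅
    IsPairMatching.empty (by simp)
  have hsubD : M.image Prod.fst ⊆ D := by
    intro z hz
    obtain ⟨p, hp, rfl⟩ := Finset.mem_image.1 hz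
    exact (hMR p hp).1
  have hsubU : M.image Prod.snd ⊆ U := by
    intro z hz
    obtain ⟨p, hp, rfl⟩ := Finset.mem_image.1 hz
    exact (hMR p hp).2.1
  have hcD := Finset.card_sdiff_add_card_eq_card hsubD
  have hcU := Finset.card_sdiff_add_card_eq_card hsubU
  rw [hM.card_image_fst] at hcD
  rw [hM.card_image_snd] at hcU
  have hcov := (((Covers.biUnion M _ fun p hp => Covers.raise_lower (hMR p hp).2.2).or
    (Covers.biUnion (D \ M.image Prod.fst) _ fun d _ => Covers.raise d)).or
    (Covers.biUnion (U \ M.image Prod.snd) _ fun u _ => Covers.lower u)).or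
    (Covers.levels hT.mid hT.up_mid hT.up_down hT.mid_down)
  have hq := h (A ∪ (U ∪ D)) _ (hcov.mono (W' := fun x y => x ∈ A ∪ (U ∪ D) ∧ y ∈ A ∪ (U ∪ D) ∧
    ¬ x ≤ y) (by
      rintro x y ⟨hx, hy, hxy⟩
      by_cases hxD : x ∈ D
      · by_cases hxM : x ∈ M.image Prod.fst
        · obtain ⟨p, hp, rfl⟩ := Finset.mem_image.1 hxM
          exact Or.inl (Or.inl (Or.inl ⟨p, hp, Or.inl ⟨rfl, hxy⟩⟩))
        · exact Or.inl (Or.inl (Or.inr ⟨x, Finset.mem_sdiff.2 ⟨hxD, hxM⟩, rfl, hxy⟩))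
      · by_cases hyU : y ∈ U
        · by_cases hyM : y ∈ M.image Prod.snd
          · obtain ⟨p, hp, rfl⟩ := Finset.mem_image.1 hyM
            exact Or.inl (Or.inl (Or.inl ⟨p, hp, Or.inr ⟨rfl, hxy⟩⟩))
          · exact Or.inl (Or.inr ⟨y, Finset.mem_sdiff.2 ⟨hyU, hyM⟩, rfl, hxy⟩)
        · simp only [Finset.mem_union] at hx hy
          right
          tauto) le_rfl)
  have hT' : ThreeLevels A (U \ M.image Prod.snd) (D \ M.image Prod.fst) :=
    hT.mono subset_rfl Finset.sdiff_subset Finset.sdiff_subset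
  refine ⟨A, U \ M.image Prod.snd, D \ M.image Prod.fst, hT', hn, ?_, ?_⟩
  · intro d hd u hu
    simp only [Finset.mem_sdiff, Finset.mem_image, not_exists, not_and] at hd hu
    exact not_not.1 (hmax d hd.1 u hu.1 hd.2 hu.2)
  · have h1 := hT.card_union
    have h2 := Finset.card_le_univ (A ∪ (U ∪ D))
    rw [Finset.card_compl, hT'.card_union]
    rw [Finset.card_compl, hT.card_union] at hρ hq
    omega

/-- Up to a few more points, the middle antichain is matched perfectly, by incomparable pairs,
with the union of the other two. -/
theorem ResistsCovers.exists_threeLevels_matched (h : ResistsCovers P n e)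
    (hcard : Fintype.card P ≤ 2 * n + 1) :
    ∃ (U D : Finset P) (μ : P → P), ThreeLevels ((U ∪ D).image μ) U D ∧
      Set.InjOn μ (U ∪ D : Finset P) ∧ (∀ d ∈ D, ∀ u ∈ U, d ≤ u) ∧ (∀ u ∈ U, ¬ μ u ≤ u) ∧
      (∀ d ∈ D, ¬ d ≤ μ d) ∧
      ((U ∪ D).image μ ∪ (U ∪ D))ᶜ.card ≤ 132 * e + 344 := by
  obtain ⟨A, U, D, hT, hn, hDU, hρ⟩ := h.exists_threeLevels_down_le_up hcard
  have hcu := hT.card_union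
  have hle := Finset.card_le_univ (A ∪ (U ∪ D))
  have hcUD : (U ∪ D).card = U.card + D.card := Finset.card_union_of_disjoint hT.disjoint_up_down
  rw [Finset.card_compl] at hρ
  let N : P → Finset P := fun w => A.filter fun a => ¬ a ≤ w ∧ ¬ w ≤ a
  -- Raise and lower the neighbours of `T`, treat the elements outside `T` one by one.
  have hcovT : ∀ T ⊆ U ∪ D, n ≤ ((T.biUnion N).card + 1 + ((U ∪ D) \ T).card + 8) +
      2 * (A ∪ (U ∪ D))ᶜ.card + e := by
    intro T hT'
    have hNA : T.biUnion N ⊆ A := by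
      intro z hz
      obtain ⟨w, -, hw⟩ := Finset.mem_biUnion.1 hz
      exact (Finset.mem_filter.1 hw).1
    have hD1 : ∀ d ∈ D, d ∉ U := fun d hd hu => hT.up_down d hu d hd le_rfl
    have hcov := (Covers.raise_and_lower_antichain
      (hT.mid.subset (Finset.coe_subset.2 hNA))).or
      (Covers.biUnion ((U ∪ D) \ T) (fun w x y => if w ∈ U then y = w ∧ ¬ x ≤ w else
        x = w ∧ ¬ w ≤ y) (by
          intro w _
          split_ifs
          exacts [Covers.lower w, Covers.raise w]))
    refine h _ _ (hT.covers (hcov.mono ?_ le_rfl))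
    rintro x y (⟨hx, hy, hxy⟩ | ⟨hx, hy, hxy⟩ | ⟨hx, hy, hxy⟩)
    · exact absurd (hDU x hx y hy) hxy
    · by_cases hyT : y ∈ T
      · refine Or.inl ⟨Or.inl (Finset.mem_biUnion.2 ⟨y, hyT, ?_⟩), hxy⟩
        exact Finset.mem_filter.2 ⟨hx, hxy, hT.up_mid y hy x hx⟩
      · refine Or.inr ⟨y, Finset.mem_sdiff.2 ⟨Finset.mem_union_left _ hy, hyT⟩, ?_⟩
        rw [if_pos hy]
        exact ⟨rfl, hxy⟩
    · by_cases hxT : x ∈ T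
      · refine Or.inl ⟨Or.inr (Finset.mem_biUnion.2 ⟨x, hxT, ?_⟩), hxy⟩
        exact Finset.mem_filter.2 ⟨hy, hT.mid_down y hy x hx, hxy⟩
      · refine Or.inr ⟨x, Finset.mem_sdiff.2 ⟨Finset.mem_union_right _ hx, hxT⟩, ?_⟩
        rw [if_neg (hD1 x hx)]
        exact ⟨rfl, hxy⟩
  have hc0 := hcovT ∅ (by simp)
  simp only [Finset.biUnion_empty, Finset.card_empty, Finset.sdiff_empty,
    Finset.card_compl] at hc0
  obtain ⟨M, hM, hMc, hMR⟩ := exists_pairMatching_of_deficiency (U ∪ D) N (30 * e + 80) (by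
    intro T hT'
    have h1 := hcovT T hT'
    have h2 := Finset.card_sdiff_add_card_eq_card hT'
    rw [Finset.card_compl] at h1
    omega)
  let μ : P → P := fun x => if h : ∃ y, (x, y) ∈ M then h.choose else x
  have hμ : ∀ p ∈ M, μ p.1 = p.2 := by
    intro p hp
    have hex : ∃ y, (p.1, y) ∈ M := ⟨p.2, hp⟩
    have h1 : (p.1, μ p.1) ∈ M := by
      simp only [μ, hex, dif_pos]
      exact hex.choose_spec
    exact (Prod.ext_iff.1 (hM.fst_inj _ h1 _ hp rfl)).2
  have hsub : M.image Prod.fst ⊆ U ∪ D := by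
    intro z hz
    obtain ⟨p, hp, rfl⟩ := Finset.mem_image.1 hz
    exact (hMR p hp).1
  have hUD' : (U ∩ M.image Prod.fst) ∪ (D ∩ M.image Prod.fst) = M.image Prod.fst := by
    rw [← Finset.union_inter_distrib_right]
    exact Finset.inter_eq_right.2 hsub
  have himg : (M.image Prod.fst).image μ = M.image Prod.snd := by
    rw [Finset.image_image]
    exact Finset.image_congr fun p hp => hμ p hp
  have hsubA : M.image Prod.snd ⊆ A := by
    intro z hz
    obtain ⟨p, hp, rfl⟩ := Finset.mem_image.1 hz
    exact (Finset.mem_filter.1 (hMR p hp).2).1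
  have hT' : ThreeLevels (M.image Prod.snd) (U ∩ M.image Prod.fst) (D ∩ M.image Prod.fst) :=
    hT.mono hsubA Finset.inter_subset_left Finset.inter_subset_left
  have hinc : ∀ w ∈ M.image Prod.fst, ¬ μ w ≤ w ∧ ¬ w ≤ μ w := by
    intro w hw
    obtain ⟨p, hp, rfl⟩ := Finset.mem_image.1 hw
    rw [hμ p hp]
    exact (Finset.mem_filter.1 (hMR p hp).2).2
  refine ⟨U ∩ M.image Prod.fst, D ∩ M.image Prod.fst, μ, ?_, ?_, ?_, ?_, ?_, ?_⟩
  · rw [hUD', himg]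
    exact hT'
  · rw [hUD']
    intro x hx y hy hxy
    obtain ⟨p, hp, rfl⟩ := Finset.mem_image.1 (Finset.mem_coe.1 hx)
    obtain ⟨p', hp', rfl⟩ := Finset.mem_image.1 (Finset.mem_coe.1 hy)
    rw [hμ p hp, hμ p' hp'] at hxy
    rw [hM.snd_inj p hp p' hp' hxy]
  · exact fun d hd u hu => hDU d (Finset.mem_inter.1 hd).1 u (Finset.mem_inter.1 hu).1
  · exact fun u hu => (hinc u (Finset.mem_inter.1 hu).2).1
  · exact fun d hd => (hinc d (Finset.mem_inter.1 hd).2).2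
  · rw [hUD', himg]
    have h1 : (M.image Prod.snd ∪ M.image Prod.fst).card = M.card + M.card := by
      have h2 := hT'.card_union
      rw [hUD', hM.card_image_snd] at h2
      have h3 := Finset.card_union_of_disjoint hT'.disjoint_up_down
      rw [hUD', hM.card_image_fst] at h3
      omega
    rw [Finset.card_compl, h1]
    omega

end ThreeLevels

/-! ### Reduction to two antichains -/

section Combine

variable {P : Type*} [PartialOrder P]

theorem monotone_ite_of_upper {p : P → Prop} [DecidablePred p] {f : P → ℕ}
    {m : ℕ}
    (hp : ∀ x y, x ≤ y → p x → p y) (hf : Monotone f) (hm : ∀ z, f z ≤ m) :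
    Monotone fun z => if p z then m else f z := by
  intro x y hxy
  have h1 := hp x y hxy
  have h2 := hf hxy
  have h3 := hm x
  dsimp only
  split_ifs <;> first | omega | (exfalso; tauto)

theorem monotone_ite_of_lower {p : P → Prop} [DecidablePred p] {f : P → ℕ}
    {m : ℕ}
    (hp : ∀ x y, x ≤ y → p y → p x) (hf : Monotone f) (hm : ∀ z, m ≤ f z) :
    Monotone fun z => if p z then m else f z := by
  intro x y hxy
  have h1 := hp x y hxy
  have h2 := hf hxy
  have h3 := hm y
  dsimp only
  split_ifs <;> first | omega | (exfalso; tauto)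

/-- One linear extension serving an upper point `u` and a lower point `d`, with partners `μ u` and
`μ d` in the middle antichain: it raises `μ u`, lowers `μ d`, puts `d` above the partners of the
other upper points and `u` below the partners of the other lower points. -/
theorem ThreeLevels.covers_combine {U D : Finset P} {μ : P → P}
    (hT : ThreeLevels ((U ∪ D).image μ) U D) (hμ : Set.InjOn μ (U ∪ D : Finset P))
    (hU : ∀ u ∈ U, ¬ μ u ≤ u) (hD : ∀ d ∈ D, ¬ d ≤ μ d) {u d : P} (hu : u ∈ U) (hd : d ∈ D) :
    Covers (fun x y => (x = μ u ∧ ¬ x ≤ y) ∨ (y = μ d ∧ ¬ x ≤ y) ∨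
      (x = d ∧ (∃ v ∈ U, v ≠ u ∧ y = μ v) ∧ ¬ x ≤ y) ∨
      (y = u ∧ (∃ v ∈ D, v ≠ d ∧ x = μ v) ∧ ¬ x ≤ y)) 1 := by
  have hmemU : ∀ v ∈ U, μ v ∈ (U ∪ D).image μ := fun v hv =>
    Finset.mem_image_of_mem _ (Finset.mem_union_left _ hv)
  have hmemD : ∀ v ∈ D, μ v ∈ (U ∪ D).image μ := fun v hv =>
    Finset.mem_image_of_mem _ (Finset.mem_union_right _ hv)
  have hmidle : ∀ v ∈ U ∪ D, ∀ w ∈ U ∪ D, μ v ≤ μ w → v = w := fun v hv w hw hle =>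
    hμ hv hw (hT.mid.eq (Finset.mem_coe.2 (Finset.mem_image_of_mem _ hv))
      (Finset.mem_coe.2 (Finset.mem_image_of_mem _ hw)) hle)
  have huU : u ∈ U ∪ D := Finset.mem_union_left _ hu
  have hdD : d ∈ U ∪ D := Finset.mem_union_right _ hd
  have hne : ∀ v ∈ U, ∀ w ∈ D, v ≠ w := fun v hv w hw h => hT.up_down v hv w hw h.le
  have hud : ¬ μ u ≤ μ d := fun h => hne u hu d hd (hmidle u huU d hdD h)
  have hf : Monotone (fun z : P => if μ u ≤ z then 5 else if z ≤ μ d then 0 else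
      if ∃ v ∈ D, v ≠ d ∧ ¬ μ v ≤ u ∧ μ v ≤ z then 3 else if d ≤ z then 2 else 1) := by
    refine monotone_ite_of_upper (fun x y hxy h => le_trans h hxy) (monotone_ite_of_lower
      (fun x y hxy h => le_trans hxy h) (monotone_ite_of_upper ?_ (monotone_ite_of_upper
      (fun x y hxy h => le_trans h hxy) monotone_const ?_) ?_) ?_) ?_
    · rintro x y hxy ⟨v, hv, hvd, hvu, hvx⟩
      exact ⟨v, hv, hvd, hvu, hvx.trans hxy⟩
    all_goals intro z; (try split_ifs) <;> omega
  refine (Covers.of_monotone hf).mono ?_ le_rfl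
  have hnd : ¬ ∃ v ∈ D, v ≠ d ∧ ¬ μ v ≤ u ∧ μ v ≤ d := fun ⟨v, hv, _, _, h⟩ =>
    hT.mid_down _ (hmemD v hv) d hd h
  have hnu : ¬ ∃ v ∈ D, v ≠ d ∧ ¬ μ v ≤ u ∧ μ v ≤ u := fun ⟨v, hv, _, h, h'⟩ => h h'
  rintro x y (⟨rfl, h⟩ | ⟨rfl, h⟩ | ⟨rfl, ⟨v, hv, hvu, rfl⟩, h⟩ | ⟨rfl, ⟨v, hv, hvd, rfl⟩, h⟩)
  · simp only [le_refl, h, if_true, if_false]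
    split_ifs <;> omega
  · simp only [le_refl, h, hud, if_true, if_false]
    split_ifs <;> omega
  · have hvU : v ∈ U ∪ D := Finset.mem_union_left _ hv
    have e1 : ¬ μ u ≤ x := hT.mid_down _ (hmemU u hu) x hd
    have e2 : ¬ μ u ≤ μ v := fun h' => hvu (hmidle u huU v hvU h').symm
    have e3 : ¬ ∃ w ∈ D, w ≠ x ∧ ¬ μ w ≤ u ∧ μ w ≤ μ v := fun ⟨w, hw, _, _, h'⟩ =>
      hne v hv w hw (hmidle w (Finset.mem_union_right _ hw) v hvU h').symm
    simp only [le_refl, h, hD x hd, hnd, e1, e2, e3, if_true, if_false]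
    split_ifs <;> omega
  · have hvD : v ∈ U ∪ D := Finset.mem_union_right _ hv
    have e1 : ¬ μ y ≤ μ v := fun h' => hne y hu v hv (hmidle y huU v hvD h')
    have e2 : ¬ μ v ≤ μ d := fun h' => hvd (hmidle v hvD d hdD h')
    have e3 : ∃ w ∈ D, w ≠ d ∧ ¬ μ w ≤ y ∧ μ w ≤ μ v := ⟨v, hv, hvd, h, le_rfl⟩
    have e4 : ¬ y ≤ μ d := hT.up_mid y hu _ (hmemD d hd)
    simp only [hU y hu, hnu, e1, e2, e3, e4, if_true, if_false]
    split_ifs <;> omega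

/-- Two antichains of points `x i` and `y i` such that no `y j` lies below an `x i`, and such that
`x i` and `y i` are incomparable. -/
structure IncomparablePairs {P : Type*} [PartialOrder P] {ι : Type*} (x y : ι → P) : Prop where
  le_fst : ∀ i j, x i ≤ x j → i = j
  le_snd : ∀ i j, y i ≤ y j → i = j
  not_snd_le_fst : ∀ i j, ¬ y i ≤ x j
  not_fst_le_snd : ∀ i, ¬ x i ≤ y i

theorem IncomparablePairs.card_union {ι : Type*} [Fintype ι] {x y : ι → P}
    (hxy : IncomparablePairs x y) :
    (Finset.univ.image x ∪ Finset.univ.image y).card = Fintype.card ι + Fintype.card ι := by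
  rw [Finset.card_union_of_disjoint, Finset.card_image_of_injective,
    Finset.card_image_of_injective, Finset.card_univ]
  · exact fun i j hij => hxy.le_snd i j hij.le
  · exact fun i j hij => hxy.le_fst i j hij.le
  · refine Finset.disjoint_left.2 fun z hz hz' => ?_
    obtain ⟨i, -, rfl⟩ := Finset.mem_image.1 hz
    obtain ⟨j, -, hj⟩ := Finset.mem_image.1 hz'
    exact hxy.not_snd_le_fst j i hj.le

variable [Fintype P] {n e ρ : ℕ}

/-- A matching `Q` between upper and lower points saves `Q.card` linear extensions, apart from the
ones needed to reverse the pairs `d, μ u` and `μ d, u` with `(u, d) ∈ Q`. -/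
theorem ResistsCovers.card_matching_le (h : ResistsCovers P n e)
    (hcard : Fintype.card P ≤ 2 * n + 1) {U D : Finset P} {μ : P → P}
    (hT : ThreeLevels ((U ∪ D).image μ) U D) (hμ : Set.InjOn μ (U ∪ D : Finset P))
    (hU : ∀ u ∈ U, ¬ μ u ≤ u) (hD : ∀ d ∈ D, ¬ d ≤ μ d) (hDU : ∀ d ∈ D, ∀ u ∈ U, d ≤ u)
    (hρ : ((U ∪ D).image μ ∪ (U ∪ D))ᶜ.card ≤ ρ) {Q : Finset (P × P)} (hQ : IsPairMatching Q)
    (hQR : ∀ p ∈ Q, p.1 ∈ U ∧ p.2 ∈ D) {q : ℕ}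
    (hq : Covers (fun x y => ∃ p ∈ Q, (x = p.2 ∧ y = μ p.1 ∧ ¬ x ≤ y) ∨
      (x = μ p.2 ∧ y = p.1 ∧ ¬ x ≤ y)) q) :
    Q.card ≤ q + 8 + 2 * ρ + e := by
  have hsubU : Q.image Prod.fst ⊆ U := by
    intro z hz
    obtain ⟨p, hp, rfl⟩ := Finset.mem_image.1 hz
    exact (hQR p hp).1
  have hsubD : Q.image Prod.snd ⊆ D := by
    intro z hz
    obtain ⟨p, hp, rfl⟩ := Finset.mem_image.1 hz
    exact (hQR p hp).2
  have hcU := Finset.card_sdiff_add_card_eq_card hsubU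
  have hcD := Finset.card_sdiff_add_card_eq_card hsubD
  rw [hQ.card_image_fst] at hcU
  rw [hQ.card_image_snd] at hcD
  have hcov := ((hq.or (Covers.biUnion Q _ fun p hp =>
    hT.covers_combine hμ hU hD (hQR p hp).1 (hQR p hp).2)).or
    (Covers.biUnion (U \ Q.image Prod.fst) _ fun u hu =>
      Covers.raise_lower (hU u (Finset.mem_sdiff.1 hu).1))).or
    (Covers.biUnion (D \ Q.image Prod.snd) _ fun d hd =>
      Covers.raise_lower (hD d (Finset.mem_sdiff.1 hd).1))
  have hmain := h _ _ (hT.covers (hcov.mono ?_ le_rfl))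
  · have h1 := hT.card_union
    have h2 := Finset.card_le_univ ((U ∪ D).image μ ∪ (U ∪ D))
    have h3 := Finset.card_union_of_disjoint hT.disjoint_up_down
    rw [Finset.card_image_of_injOn hμ] at h1
    omega
  · rintro x y (⟨hx, hy, hxy⟩ | ⟨hx, hy, hxy⟩ | ⟨hx, hy, hxy⟩)
    · exact absurd (hDU x hx y hy) hxy
    · obtain ⟨v, hv, rfl⟩ := Finset.mem_image.1 hx
      rcases Finset.mem_union.1 hv with hv | hv
      · by_cases hvQ : v ∈ Q.image Prod.fst
        · obtain ⟨p, hp, rfl⟩ := Finset.mem_image.1 hvQ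
          exact Or.inl (Or.inl (Or.inr ⟨p, hp, Or.inl ⟨rfl, hxy⟩⟩))
        · exact Or.inl (Or.inr ⟨v, Finset.mem_sdiff.2 ⟨hv, hvQ⟩, Or.inl ⟨rfl, hxy⟩⟩)
      · by_cases hyQ : y ∈ Q.image Prod.fst
        · obtain ⟨p, hp, rfl⟩ := Finset.mem_image.1 hyQ
          by_cases hvp : v = p.2
          · subst hvp
            exact Or.inl (Or.inl (Or.inl ⟨p, hp, Or.inr ⟨rfl, rfl, hxy⟩⟩))
          · exact Or.inl (Or.inl (Or.inr ⟨p, hp, Or.inr (Or.inr (Or.inr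
              ⟨rfl, ⟨v, hv, hvp, rfl⟩, hxy⟩))⟩))
        · exact Or.inl (Or.inr ⟨y, Finset.mem_sdiff.2 ⟨hy, hyQ⟩, Or.inr ⟨rfl, hxy⟩⟩)
    · obtain ⟨v, hv, rfl⟩ := Finset.mem_image.1 hy
      rcases Finset.mem_union.1 hv with hv | hv
      · by_cases hxQ : x ∈ Q.image Prod.snd
        · obtain ⟨p, hp, rfl⟩ := Finset.mem_image.1 hxQ
          by_cases hvp : v = p.1
          · subst hvp
            exact Or.inl (Or.inl (Or.inl ⟨p, hp, Or.inl ⟨rfl, rfl, hxy⟩⟩))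
          · exact Or.inl (Or.inl (Or.inr ⟨p, hp, Or.inr (Or.inr (Or.inl
              ⟨rfl, ⟨v, hv, hvp, rfl⟩, hxy⟩))⟩))
        · exact Or.inr ⟨x, Finset.mem_sdiff.2 ⟨hx, hxQ⟩, Or.inl ⟨rfl, hxy⟩⟩
      · by_cases hvQ : v ∈ Q.image Prod.snd
        · obtain ⟨p, hp, rfl⟩ := Finset.mem_image.1 hvQ
          exact Or.inl (Or.inl (Or.inr ⟨p, hp, Or.inr (Or.inl ⟨rfl, hxy⟩)⟩))
        · exact Or.inr ⟨v, Finset.mem_sdiff.2 ⟨hv, hvQ⟩, Or.inr ⟨rfl, hxy⟩⟩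

/-- One of the two outer antichains is small. Otherwise there is a large matching `Q` between them
for which the pairs `d, μ u` and `μ d, u` cost little: by a dichotomy applied to each of the two
kinds, either many pairs of `Q` need not be reversed, or none of them is comparable, in which case
one linear extension reverses all of them. -/
theorem ResistsCovers.card_up_or_down_lt (h : ResistsCovers P n e)
    (hcard : Fintype.card P ≤ 2 * n + 1) {U D : Finset P} {μ : P → P}
    (hT : ThreeLevels ((U ∪ D).image μ) U D) (hμ : Set.InjOn μ (U ∪ D : Finset P))
    (hU : ∀ u ∈ U, ¬ μ u ≤ u) (hD : ∀ d ∈ D, ¬ d ≤ μ d) (hDU : ∀ d ∈ D, ∀ u ∈ U, d ≤ u)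
    (hρ : ((U ∪ D).image μ ∪ (U ∪ D))ᶜ.card ≤ ρ) :
    U.card < 5 * (11 + 2 * ρ + e) ∨ D.card < 5 * (11 + 2 * ρ + e) := by
  by_contra! hlarge
  obtain ⟨hlU, hlD⟩ := hlarge
  obtain ⟨s, hs⟩ : ∃ s, s = 11 + 2 * ρ + e := ⟨_, rfl⟩
  rw [← hs] at hlU hlD
  have hQle := fun (Q : Finset (P × P)) hQ hQR (q : ℕ) hq =>
    h.card_matching_le hcard hT hμ hU hD hDU hρ (Q := Q) hQ hQR (q := q) hq
  -- If one extension suffices for either kind of pair, the matching is small.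
  have htwo : ∀ Q : Finset (P × P), IsPairMatching Q → (∀ p ∈ Q, p.1 ∈ U ∧ p.2 ∈ D) →
      Covers (fun x y => ∃ p ∈ Q, x = p.2 ∧ y = μ p.1 ∧ ¬ x ≤ y) 1 →
      Covers (fun x y => ∃ p ∈ Q, x = μ p.2 ∧ y = p.1 ∧ ¬ x ≤ y) 1 → Q.card < s := by
    intro Q hQ hQR h1 h2
    have := hQle Q hQ hQR 2 ((h1.or h2).mono (by
      rintro x y ⟨p, hp, hxy | hxy⟩
      exacts [Or.inl ⟨p, hp, hxy⟩, Or.inr ⟨p, hp, hxy⟩]) (by norm_num))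
    omega
  have hgood1 : ∀ Q : Finset (P × P), (∀ p ∈ Q, p.2 ≤ μ p.1) →
      Covers (fun x y => ∃ p ∈ Q, x = p.2 ∧ y = μ p.1 ∧ ¬ x ≤ y) 1 := by
    intro Q hQ
    refine Covers.of_false.mono ?_ zero_le_one
    rintro x y ⟨p, hp, rfl, rfl, hxy⟩
    exact hxy (hQ p hp)
  have hgood2 : ∀ Q : Finset (P × P), (∀ p ∈ Q, μ p.2 ≤ p.1) →
      Covers (fun x y => ∃ p ∈ Q, x = μ p.2 ∧ y = p.1 ∧ ¬ x ≤ y) 1 := by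
    intro Q hQ
    refine Covers.of_false.mono ?_ zero_le_one
    rintro x y ⟨p, hp, rfl, rfl, hxy⟩
    exact hxy (hQ p hp)
  have hfree1 : ∀ U' D' : Finset P, (∀ u ∈ U', ∀ d ∈ D', ¬ d ≤ μ u) → ∀ Q : Finset (P × P),
      (∀ p ∈ Q, p.1 ∈ U' ∧ p.2 ∈ D') →
      Covers (fun x y => ∃ p ∈ Q, x = p.2 ∧ y = μ p.1 ∧ ¬ x ≤ y) 1 := by
    intro U' D' hfree Q hQ
    refine (Covers.raise_set (U := D') (Z := U'.image μ) ?_).mono ?_ le_rfl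
    · intro d hd z hz
      obtain ⟨u, hu, rfl⟩ := Finset.mem_image.1 hz
      exact hfree u hu d hd
    · rintro x y ⟨p, hp, rfl, rfl, -⟩
      exact ⟨(hQ p hp).2, Finset.mem_image_of_mem _ (hQ p hp).1⟩
  have hfree2 : ∀ U' D' : Finset P, (∀ u ∈ U', ∀ d ∈ D', ¬ μ d ≤ u) → ∀ Q : Finset (P × P),
      (∀ p ∈ Q, p.1 ∈ U' ∧ p.2 ∈ D') →
      Covers (fun x y => ∃ p ∈ Q, x = μ p.2 ∧ y = p.1 ∧ ¬ x ≤ y) 1 := by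
    intro U' D' hfree Q hQ
    refine (Covers.raise_set (U := D'.image μ) (Z := U') ?_).mono ?_ le_rfl
    · intro z hz u hu
      obtain ⟨d, hd, rfl⟩ := Finset.mem_image.1 hz
      exact hfree u hu d hd
    · rintro x y ⟨p, hp, rfl, rfl, -⟩
      exact ⟨Finset.mem_image_of_mem _ (hQ p hp).2, (hQ p hp).1⟩
  have hspos : 0 < s := by omega
  have hfree12 : ∀ U' ⊆ U, ∀ D' ⊆ D, s < U'.card → s < D'.card →
      (∀ u ∈ U', ∀ d ∈ D', ¬ d ≤ μ u) → (∀ u ∈ U', ∀ d ∈ D', ¬ μ d ≤ u) → False := by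
    intro U' hU' D' hD' hcU hcD hf1 hf2
    rcases exists_matching_or_free (fun _ _ => True) U' D' s with
      ⟨Q, hQ, hQc, hQR⟩ | ⟨X, -, Y, -, hX, hY, hXY⟩
    · have := htwo Q hQ (fun p hp => ⟨hU' (hQR p hp).1, hD' (hQR p hp).2.1⟩)
        (hfree1 U' D' hf1 Q fun p hp => ⟨(hQR p hp).1, (hQR p hp).2.1⟩)
        (hfree2 U' D' hf2 Q fun p hp => ⟨(hQR p hp).1, (hQR p hp).2.1⟩)
      omega
    · obtain ⟨x, hx⟩ := Finset.card_pos.1 (show 0 < X.card by omega)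
      obtain ⟨y, hy⟩ := Finset.card_pos.1 (show 0 < Y.card by omega)
      exact hXY x hx y hy trivial
  rcases exists_matching_or_free (fun u d => d ≤ μ u) U D s with
    ⟨Q₁, hQ₁, hQ₁c, hQ₁R⟩ | ⟨U', hU', D', hD', hU'c, hD'c, hf1⟩
  · have hc1 := Finset.le_card_sdiff (Q₁.image Prod.fst) U
    have hc2 := Finset.le_card_sdiff (Q₁.image Prod.snd) D
    rw [hQ₁.card_image_fst] at hc1
    rw [hQ₁.card_image_snd] at hc2
    rcases exists_matching_or_free (fun u d => μ d ≤ u) (U \ Q₁.image Prod.fst)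
      (D \ Q₁.image Prod.snd) s with
      ⟨Q₂, hQ₂, hQ₂c, hQ₂R⟩ | ⟨U', hU', D', hD', hU'c, hD'c, hf2⟩
    · -- The bad pair of an element of `Q₁` and that of an element of `Q₂` share an extension.
      have hd1 : ∀ p ∈ Q₁, ∀ p' ∈ Q₂, p.1 ≠ p'.1 := fun p hp p' hp' heq =>
        (Finset.mem_sdiff.1 (hQ₂R p' hp').1).2 (Finset.mem_image.2 ⟨p, hp, heq⟩)
      have hd2 : ∀ p ∈ Q₁, ∀ p' ∈ Q₂, p.2 ≠ p'.2 := fun p hp p' hp' heq =>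
        (Finset.mem_sdiff.1 (hQ₂R p' hp').2.1).2 (Finset.mem_image.2 ⟨p, hp, heq⟩)
      have hQR : ∀ p ∈ Q₁ ∪ Q₂, p.1 ∈ U ∧ p.2 ∈ D := by
        intro p hp
        rcases Finset.mem_union.1 hp with hp | hp
        · exact ⟨(hQ₁R p hp).1, (hQ₁R p hp).2.1⟩
        · exact ⟨(Finset.mem_sdiff.1 (hQ₂R p hp).1).1, (Finset.mem_sdiff.1 (hQ₂R p hp).2.1).1⟩
      have hdisj : Disjoint Q₁ Q₂ :=
        Finset.disjoint_left.2 fun p hp hp' => hd1 p hp p hp' rfl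
      obtain ⟨φ⟩ : Nonempty (Q₁ ≃ Q₂) := ⟨Finset.equivOfCardEq (hQ₁c.trans hQ₂c.symm)⟩
      have hpair : ∀ p ∈ (Finset.univ : Finset Q₁), Covers (fun x y =>
          (x = μ p.1.2 ∧ y = p.1.1 ∧ ¬ x ≤ y) ∨
            (x = (φ p).1.2 ∧ y = μ (φ p).1.1 ∧ ¬ x ≤ y)) 1 := by
        intro p _
        obtain ⟨hp1, hp2⟩ := hQR _ (Finset.mem_union_left _ p.2)
        obtain ⟨hq1, hq2⟩ := hQR _ (Finset.mem_union_right _ (φ p).2)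
        have hf : Monotone (fun z : P => (if (φ p).1.2 ≤ z then 1 else 0) +
            if μ p.1.2 ≤ z then 2 else 0) := by
          intro x y hxy
          have h1 : (φ p).1.2 ≤ x → (φ p).1.2 ≤ y := fun h => h.trans hxy
          have h2 : μ p.1.2 ≤ x → μ p.1.2 ≤ y := fun h => h.trans hxy
          dsimp only
          split_ifs <;> first | omega | (exfalso; tauto)
        refine (Covers.of_monotone hf).mono ?_ le_rfl
        rintro x y (⟨rfl, rfl, hxy⟩ | ⟨rfl, rfl, hxy⟩)
        · simp only [le_refl, hxy, if_true, if_false]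
          split_ifs <;> omega
        · have h1 : ¬ μ p.1.2 ≤ μ (φ p).1.1 := by
            intro hle
            have hp2' := Finset.mem_union_right U hp2
            have hq1' := Finset.mem_union_left D hq1
            have := hμ hp2' hq1' (hT.mid.eq (Finset.mem_coe.2 (Finset.mem_image_of_mem _ hp2'))
              (Finset.mem_coe.2 (Finset.mem_image_of_mem _ hq1')) hle)
            exact hT.up_down _ hq1 _ hp2 this.ge
          simp only [le_refl, hxy, h1, if_true, if_false]
          split_ifs <;> omega
      have := hQle (Q₁ ∪ Q₂) (hQ₁.union hQ₂ hd1 hd2) hQR s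
        ((Covers.biUnion Finset.univ _ hpair).mono ?_ (by simp [hQ₁c]))
      · rw [Finset.card_union_of_disjoint hdisj] at this
        omega
      · rintro x y ⟨p, hp, hxy⟩
        rcases Finset.mem_union.1 hp with hp | hp
        · rcases hxy with ⟨rfl, rfl, hxy⟩ | hxy
          · exact absurd (hQ₁R p hp).2.2 hxy
          · exact ⟨⟨p, hp⟩, Finset.mem_univ _, Or.inl hxy⟩
        · rcases hxy with hxy | ⟨rfl, rfl, hxy⟩
          · refine ⟨φ.symm ⟨p, hp⟩, Finset.mem_univ _, Or.inr ?_⟩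
            simpa using hxy
          · exact absurd (hQ₂R p hp).2.2 hxy
    · have hU'U := hU'.trans Finset.sdiff_subset
      have hD'D := hD'.trans Finset.sdiff_subset
      rcases exists_matching_or_free (fun u d => d ≤ μ u) U' D' s with
        ⟨Q, hQ, hQc, hQR⟩ | ⟨U'', hU'', D'', hD'', hU''c, hD''c, hf1⟩
      · have := htwo Q hQ (fun p hp => ⟨hU'U (hQR p hp).1, hD'D (hQR p hp).2.1⟩)
          (hgood1 Q fun p hp => (hQR p hp).2.2)
          (hfree2 U' D' hf2 Q fun p hp => ⟨(hQR p hp).1, (hQR p hp).2.1⟩)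
        omega
      · exact hfree12 U'' (hU''.trans hU'U) D'' (hD''.trans hD'D) (by omega) (by omega) hf1
          fun u hu d hd => hf2 u (hU'' hu) d (hD'' hd)
  · rcases exists_matching_or_free (fun u d => μ d ≤ u) U' D' s with
      ⟨Q, hQ, hQc, hQR⟩ | ⟨U'', hU'', D'', hD'', hU''c, hD''c, hf2⟩
    · have := htwo Q hQ (fun p hp => ⟨hU' (hQR p hp).1, hD' (hQR p hp).2.1⟩)
        (hfree1 U' D' hf1 Q fun p hp => ⟨(hQR p hp).1, (hQR p hp).2.1⟩)
        (hgood2 Q fun p hp => (hQR p hp).2.2)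
      omega
    · exact hfree12 U'' (hU''.trans hU') D'' (hD''.trans hD') (by omega) (by omega)
        (fun u hu d hd => hf1 u (hU'' hu) d (hD'' hd)) hf2

/-- Up to a few points, the poset consists of two antichains matched by incomparable pairs. -/
theorem ResistsCovers.exists_incomparablePairs (h : ResistsCovers P n e) (he : 1 ≤ e)
    (hcard : Fintype.card P ≤ 2 * n + 1) :
    ∃ (J : Finset P) (x y : J → P), IncomparablePairs x y ∧
      (Finset.univ.image x ∪ Finset.univ.image y)ᶜ.card ≤ 10116 * e := by
  obtain ⟨U, D, μ, hT, hμ, hDU, hU, hD, hρ⟩ := h.exists_threeLevels_matched hcard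
  have hcases := h.card_up_or_down_lt hcard hT hμ hU hD hDU hρ
  have hcu := hT.card_union
  have h3 := Finset.card_union_of_disjoint hT.disjoint_up_down
  rw [Finset.card_image_of_injOn hμ] at hcu
  have hmidle : ∀ v ∈ U ∪ D, ∀ w ∈ U ∪ D, μ v ≤ μ w → v = w := fun v hv w hw hle =>
    hμ hv hw (hT.mid.eq (Finset.mem_coe.2 (Finset.mem_image_of_mem _ hv))
      (Finset.mem_coe.2 (Finset.mem_image_of_mem _ hw)) hle)
  have hmem : ∀ J ⊆ U ∪ D, ∀ i : J, (i : P) ∈ U ∪ D := fun J hJ i => hJ i.2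
  rw [Finset.card_compl] at hρ
  rcases hcases with hc | hc
  · have hp : IncomparablePairs (fun i : D => (i : P)) (fun i : D => μ i) :=
      ⟨fun i j hij => Subtype.ext (hT.down.eq i.2 j.2 hij),
        fun i j hij => Subtype.ext (hmidle i (hmem D Finset.subset_union_right i) j
          (hmem D Finset.subset_union_right j) hij),
        fun i j => hT.mid_down _ (Finset.mem_image_of_mem _ (hmem D Finset.subset_union_right i))
          _ j.2,
        fun i => hD i i.2⟩
    refine ⟨D, _, _, hp, ?_⟩
    rw [Finset.card_compl, hp.card_union, Fintype.card_coe]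
    omega
  · have hp : IncomparablePairs (fun i : U => μ i) (fun i : U => (i : P)) :=
      ⟨fun i j hij => Subtype.ext (hmidle i (hmem U Finset.subset_union_left i) j
          (hmem U Finset.subset_union_left j) hij),
        fun i j hij => Subtype.ext (hT.up.eq i.2 j.2 hij),
        fun i j => hT.up_mid _ i.2 _
          (Finset.mem_image_of_mem _ (hmem U Finset.subset_union_left j)),
        fun i => hU i i.2⟩
    refine ⟨U, _, _, hp, ?_⟩
    rw [Finset.card_compl, hp.card_union, Fintype.card_coe]
    omega

end Combine

/-! ### Serving the conflicts in a relation -/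

section Conflicts

variable {ι : Type*}

/-- `d * (1 - (d - b) / m) ^ L` is at most `b + m / L`, where differences are truncated at `0`. -/
theorem mul_one_sub_pow_le {d b m : ℝ} {L : ℕ} (hb : 0 ≤ b) (hm : 0 < m)
    (hdm : d ≤ m) (hL : 0 < L) : d * (1 - max 0 (d - b) / m) ^ L ≤ b + m / L := by
  have hL' : (0 : ℝ) < L := Nat.cast_pos.2 hL
  set y := max 0 (d - b) / m with hy
  have hy0 : 0 ≤ y := by positivity
  have hy1 : y ≤ 1 := by
    rw [hy, div_le_one hm]
    exact max_le hm.le (by linarith)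
  have hdle : d ≤ b + m * y := by
    have : m * y = max 0 (d - b) := by rw [hy]; field_simp
    rw [this]
    linarith [le_max_right 0 (d - b)]
  have hp0 : 0 ≤ (1 - y) ^ L := pow_nonneg (by linarith) _
  have hp1 : (1 - y) ^ L ≤ 1 := pow_le_one₀ (by linarith) (by linarith)
  have hbern : 1 + L * y ≤ (1 + y) ^ L := one_add_mul_le_pow (by linarith) L
  have hprod : (1 - y) ^ L * (1 + y) ^ L ≤ 1 := by
    rw [← mul_pow]
    exact pow_le_one₀ (by nlinarith) (by nlinarith)
  have hyL : y * (1 - y) ^ L ≤ 1 / L := by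
    rw [le_div_iff₀ hL']
    nlinarith [mul_le_mul_of_nonneg_left hbern hp0]
  calc d * (1 - y) ^ L ≤ (b + m * y) * (1 - y) ^ L := mul_le_mul_of_nonneg_right hdle hp0
    _ = b * (1 - y) ^ L + m * (y * (1 - y) ^ L) := by ring
    _ ≤ b * 1 + m * (1 / L) := by gcongr
    _ = b + m / L := by ring

/-- A matching of at most `L` pairs of `K` between `X` and `Y` whose second coordinates leave few
elements of `X` without a neighbour. The bound is the expected number for `L` independent random
elements of `Y`; the elements are chosen one by one so that the expectation does not increase. -/
theorem exists_matching_dominating (K : ι → ι → Prop) (Y : Finset ι) (L : ℕ) :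
    ∀ X : Finset ι, ∃ Q : Finset (ι × ι), IsPairMatching Q ∧ Q.card ≤ L ∧
      (∀ p ∈ Q, p.1 ∈ X ∧ p.2 ∈ Y ∧ K p.1 p.2) ∧
      ((X.filter fun t => ∀ p ∈ Q, ¬ K t p.2).card : ℝ) ≤
        ∑ t ∈ X, (1 - ((Y.filter (K t)).card : ℝ) / Y.card) ^ L := by
  induction L with
  | zero =>
    intro X
    exact ⟨∅, IsPairMatching.empty, by simp, by simp, by simp⟩
  | succ L ih =>
    intro X
    rcases Y.eq_empty_or_nonempty with rfl | hY
    · exact ⟨∅, IsPairMatching.empty, by simp, by simp, by simp⟩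
    have hN : (0 : ℝ) < Y.card := Nat.cast_pos.2 (Finset.card_pos.2 hY)
    let w : ι → ℝ := fun t => 1 - ((Y.filter (K t)).card : ℝ) / Y.card
    obtain ⟨r, hr, hle⟩ : ∃ r ∈ Y, ∑ t ∈ X.filter (fun t => ¬ K t r), w t ^ L ≤
        ∑ t ∈ X, w t ^ (L + 1) := by
      refine Finset.exists_le_of_sum_le hY ?_
      have h1 : ∑ r ∈ Y, ∑ t ∈ X.filter (fun t => ¬ K t r), w t ^ L =
          ∑ t ∈ X, ∑ r ∈ Y, if ¬ K t r then w t ^ L else 0 := by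
        rw [Finset.sum_comm]
        exact Finset.sum_congr rfl fun r _ => Finset.sum_filter _ _
      rw [h1, Finset.sum_const, nsmul_eq_mul, Finset.mul_sum]
      refine Finset.sum_le_sum fun t _ => ?_
      rw [← Finset.sum_filter, Finset.sum_const, nsmul_eq_mul]
      have h2 : ((Y.filter fun r => ¬ K t r).card : ℝ) = Y.card * w t := by
        have h3 := Finset.card_filter_add_card_filter_not (s := Y) (K t)
        have h4 : ((Y.filter (K t)).card : ℝ) + (Y.filter fun r => ¬ K t r).card = Y.card := by
          exact_mod_cast h3
        simp only [w]
        field_simp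
        linarith
      rw [h2, pow_succ]
      exact le_of_eq (by ring)
    obtain ⟨Q, hQ, hQc, hQR, hQu⟩ := ih (X.filter fun t => ¬ K t r)
    by_cases hs : ∃ s ∈ X, K s r
    · obtain ⟨s, hsX, hsr⟩ := hs
      refine ⟨insert (s, r) Q, hQ.insert ?_ ?_, ?_, ?_, ?_⟩
      · rintro p hp rfl
        exact (Finset.mem_filter.1 (hQR p hp).1).2 hsr
      · rintro p hp rfl
        exact (Finset.mem_filter.1 (hQR p hp).1).2 (hQR p hp).2.2
      · exact (Finset.card_insert_le _ _).trans (by omega)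
      · intro p hp
        rcases Finset.mem_insert.1 hp with rfl | hp
        · exact ⟨hsX, hr, hsr⟩
        · exact ⟨(Finset.mem_filter.1 (hQR p hp).1).1, (hQR p hp).2⟩
      · refine le_trans ?_ (hQu.trans hle)
        refine Nat.cast_le.2 (Finset.card_le_card ?_)
        intro t ht
        simp only [Finset.mem_filter, Finset.mem_insert, forall_eq_or_imp] at ht ⊢
        exact ⟨⟨ht.1, ht.2.1⟩, ht.2.2⟩
    · have hX : X.filter (fun t => ¬ K t r) = X :=
        Finset.filter_true_of_mem fun t ht hK => hs ⟨t, ht, hK⟩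
      rw [hX] at hQR hQu hle
      exact ⟨Q, hQ, by omega, hQR, hQu.trans hle⟩

/-- The version of `exists_matching_dominating` in which almost all of `T` is available, with the
error term in a form that does not depend on the available part `Y`. -/
theorem exists_matching_dominating_of_card_sdiff (K : ι → ι → Prop) {X Y T : Finset ι} {L b : ℕ}
    (hY : Y ⊆ T) (hb : (T \ Y).card ≤ b) :
    ∃ Q : Finset (ι × ι), IsPairMatching Q ∧ Q.card ≤ L ∧
      (∀ p ∈ Q, p.1 ∈ X ∧ p.2 ∈ Y ∧ K p.1 p.2) ∧
      ((X.filter fun t => ∀ p ∈ Q, ¬ K t p.2).card : ℝ) ≤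
        ∑ t ∈ X, (1 - max 0 (((T.filter (K t)).card : ℝ) - b) / T.card) ^ L := by
  obtain ⟨Q, hQ, hQc, hQR, hQu⟩ := exists_matching_dominating K Y L X
  refine ⟨Q, hQ, hQc, hQR, hQu.trans (Finset.sum_le_sum fun t _ => ?_)⟩
  have h1 : ((Y.filter (K t)).card : ℝ) ≤ Y.card := Nat.cast_le.2 (Finset.card_filter_le _ _)
  have h2 : ((Y.card : ℕ) : ℝ) ≤ T.card := Nat.cast_le.2 (Finset.card_le_card hY)
  have h3 : ((T.filter (K t)).card : ℝ) ≤ (Y.filter (K t)).card + b := by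
    have : T.filter (K t) ⊆ Y.filter (K t) ∪ T \ Y := by
      intro z hz
      simp only [Finset.mem_filter, Finset.mem_union, Finset.mem_sdiff] at hz ⊢
      tauto
    have := (Finset.card_le_card this).trans (Finset.card_union_le _ _)
    exact_mod_cast this.trans (by omega)
  rcases (Nat.cast_nonneg (α := ℝ) Y.card).eq_or_lt with h0 | h0
  · have hd : ((Y.filter (K t)).card : ℝ) = 0 :=
      le_antisymm (h1.trans h0.ge) (Nat.cast_nonneg _)
    have hmax : max 0 (((T.filter (K t)).card : ℝ) - b) = 0 := max_eq_left (by linarith)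
    rw [hd, hmax]
    simp
  · refine pow_le_pow_left₀ ?_ ?_ L
    · have := (div_le_one h0).2 h1
      linarith
    · have h4 : max 0 (((T.filter (K t)).card : ℝ) - b) ≤ (Y.filter (K t)).card :=
        max_le (Nat.cast_nonneg _) (by linarith)
      have := div_le_div₀ (Nat.cast_nonneg _) h4 h0 h2
      linarith

/-- In a pool `T` there is an index `u` such that, after the deletion of few indices, all pairs of
`K` between `u` and the rest of the pool are served by a matching `Qin ∪ Qout` on deleted indices:
`K t u` by an element `(s, r)` of `Qin` with `K s u` and `K t r`, and `K u t` by an element `(s, r)`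
of `Qout` with `K s t` and `K u r`. The index `u` is found by averaging the error terms of
`exists_matching_dominating_of_card_sdiff`. -/
theorem exists_index_served (K : ι → ι → Prop) {T : Finset ι} (hT : T.Nonempty) {k : ℕ}
    (hk : 0 < k) (hTk : T.card ≤ 80 * k ^ 2) :
    ∃ u ∈ T, ∃ Qin Qout : Finset (ι × ι), ∃ T' ⊆ T, T.card ≤ T'.card + 75 * k ∧ u ∉ T' ∧
      IsPairMatching (Qin ∪ Qout) ∧ Disjoint Qin Qout ∧
      (∀ p ∈ Qin ∪ Qout, (p.1 ∈ T ∧ p.1 ∉ T' ∧ p.1 ≠ u) ∧ (p.2 ∈ T ∧ p.2 ∉ T' ∧ p.2 ≠ u) ∧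
        K p.1 p.2) ∧
      (∀ t ∈ T', K t u → ∃ p ∈ Qin, K p.1 u ∧ K t p.2) ∧
      (∀ t ∈ T', K u t → ∃ p ∈ Qout, K p.1 t ∧ K u p.2) := by
  have hm : (0 : ℝ) < T.card := Nat.cast_pos.2 (Finset.card_pos.2 hT)
  -- With `L = 4 * k`, the `m / L` terms for a pool of size `m ≤ 80 * k ^ 2` add up to at most
  -- `40 * k`, and the terms proportional to `L` to `32 * k + 3`.
  obtain ⟨L, hL⟩ : ∃ L, L = 4 * k := ⟨_, rfl⟩
  obtain ⟨b, hb⟩ : ∃ b, b = 2 * L + 1 := ⟨_, rfl⟩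
  let g : ℝ → ℝ := fun d => (1 - max 0 (d - b) / T.card) ^ L
  have hg : ∀ d : ℕ, d ≤ T.card → d * g d ≤ b + (T.card : ℝ) / L := fun d hd =>
    mul_one_sub_pow_le (Nat.cast_nonneg _) hm (Nat.cast_le.2 hd) (by omega)
  have hg0 : ∀ d : ℕ, d ≤ T.card → 0 ≤ g d := by
    intro d hd
    refine pow_nonneg (sub_nonneg.2 ((div_le_one hm).2 (max_le hm.le ?_))) _
    have h1 : (d : ℝ) ≤ T.card := Nat.cast_le.2 hd
    have h2 : (0 : ℝ) ≤ b := Nat.cast_nonneg _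
    linarith
  let dout : ι → ℕ := fun t => (T.filter (K t)).card
  let din : ι → ℕ := fun t => (T.filter fun s => K s t).card
  have hdout : ∀ t, dout t ≤ T.card := fun t => Finset.card_filter_le _ _
  have hdin : ∀ t, din t ≤ T.card := fun t => Finset.card_filter_le _ _
  have havg : ∀ (R : ι → ι → Prop), ∑ u ∈ T, ∑ t ∈ T.filter (fun t => R t u),
      g (T.filter (R t)).card ≤ T.card * (b + (T.card : ℝ) / L) := by
    intro R
    have h1 : ∑ u ∈ T, ∑ t ∈ T.filter (fun t => R t u), g (T.filter (R t)).card =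
        ∑ t ∈ T, ∑ u ∈ T, if R t u then g (T.filter (R t)).card else 0 := by
      rw [Finset.sum_comm]
      exact Finset.sum_congr rfl fun r _ => Finset.sum_filter _ _
    rw [h1, ← nsmul_eq_mul, ← Finset.sum_const]
    refine Finset.sum_le_sum fun t _ => ?_
    rw [← Finset.sum_filter, Finset.sum_const, nsmul_eq_mul]
    exact hg _ (Finset.card_filter_le _ _)
  obtain ⟨u, hu, hule⟩ : ∃ u ∈ T, (∑ t ∈ T.filter (fun t => K t u), g (dout t)) +
      (∑ t ∈ T.filter (fun t => K u t), g (din t)) ≤ 2 * (b + (T.card : ℝ) / L) := by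
    refine Finset.exists_le_of_sum_le hT ?_
    rw [Finset.sum_add_distrib, Finset.sum_const, nsmul_eq_mul]
    have h1 := havg K
    have h2 := havg fun t s => K s t
    simp only [dout, din]
    linarith
  -- The pairs of `K` leading to `u`.
  obtain ⟨Q₁, hQ₁, hQ₁c, hQ₁R, hQ₁u⟩ := exists_matching_dominating_of_card_sdiff K
    (X := (T.erase u).filter fun t => K t u) (Y := T.erase u) (T := T) (L := L) (b := b)
    (Finset.erase_subset _ _) (by
      have h1 := Finset.card_sdiff_add_card_eq_card (Finset.erase_subset u T)
      have h2 := Finset.card_erase_add_one hu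
      omega)
  let V₁ := Q₁.image Prod.fst ∪ Q₁.image Prod.snd
  have hV₁ : V₁.card ≤ 2 * L := by
    refine (Finset.card_union_le _ _).trans ?_
    rw [hQ₁.card_image_fst, hQ₁.card_image_snd]
    omega
  -- The pairs of `K` starting from `u`, by the same argument for the converse relation.
  obtain ⟨Q₂, hQ₂, hQ₂c, hQ₂R, hQ₂u⟩ := exists_matching_dominating_of_card_sdiff
    (fun t s => K s t) (X := (T.erase u \ V₁).filter fun t => K u t) (Y := T.erase u \ V₁)
    (T := T) (L := L) (b := b) (Finset.sdiff_subset.trans (Finset.erase_subset _ _)) (by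
      have h1 := Finset.card_sdiff_add_card_eq_card
        ((Finset.sdiff_subset (s := T.erase u) (t := V₁)).trans (Finset.erase_subset u T))
      have h2 := Finset.card_erase_add_one hu
      have h3 := Finset.le_card_sdiff V₁ (T.erase u)
      omega)
  let V₂ := Q₂.image Prod.fst ∪ Q₂.image Prod.snd
  have hV₂ : V₂.card ≤ 2 * L := by
    refine (Finset.card_union_le _ _).trans ?_
    rw [hQ₂.card_image_fst, hQ₂.card_image_snd]
    omega
  let B₁ := ((T.erase u).filter fun t => K t u).filter fun t => ∀ p ∈ Q₁, ¬ K t p.2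
  let B₂ := ((T.erase u \ V₁).filter fun t => K u t).filter fun t => ∀ p ∈ Q₂, ¬ K p.2 t
  let Qout := Q₂.image Prod.swap
  have hQout : ∀ p, p ∈ Qout ↔ (p.2, p.1) ∈ Q₂ := by
    intro p
    simp only [Qout, Finset.mem_image]
    constructor
    · rintro ⟨q, hq, rfl⟩
      exact hq
    · intro h
      exact ⟨_, h, rfl⟩
  have hm₁ : ∀ p ∈ Q₁, p.1 ∈ V₁ ∧ p.2 ∈ V₁ := fun p hp =>
    ⟨Finset.mem_union_left _ (Finset.mem_image_of_mem _ hp),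
      Finset.mem_union_right _ (Finset.mem_image_of_mem _ hp)⟩
  have hm₂ : ∀ p ∈ Qout, p.1 ∈ V₂ ∧ p.2 ∈ V₂ := fun p hp =>
    ⟨Finset.mem_union_right _ (Finset.mem_image.2 ⟨_, (hQout p).1 hp, rfl⟩),
      Finset.mem_union_left _ (Finset.mem_image.2 ⟨_, (hQout p).1 hp, rfl⟩)⟩
  have hn₂ : ∀ p ∈ Qout, (p.1 ∈ T.erase u ∧ p.1 ∉ V₁) ∧ (p.2 ∈ T.erase u ∧ p.2 ∉ V₁) := by
    intro p hp
    obtain ⟨h1, h2, -⟩ := hQ₂R _ ((hQout p).1 hp)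
    exact ⟨Finset.mem_sdiff.1 h2, Finset.mem_sdiff.1 (Finset.mem_filter.1 h1).1⟩
  refine ⟨u, hu, Q₁, Qout, T.erase u \ (V₁ ∪ V₂ ∪ B₁ ∪ B₂),
    Finset.sdiff_subset.trans (Finset.erase_subset _ _), ?_, by simp, ?_, ?_, ?_, ?_, ?_⟩
  · have hB : (B₁.card : ℝ) + B₂.card ≤ 2 * (b + (T.card : ℝ) / L) := by
      refine le_trans (add_le_add (hQ₁u.trans ?_) (hQ₂u.trans ?_)) hule
      · refine Finset.sum_le_sum_of_subset_of_nonneg ?_ fun t _ _ => hg0 _ (hdout t)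
        exact Finset.filter_subset_filter _ (Finset.erase_subset _ _)
      · refine Finset.sum_le_sum_of_subset_of_nonneg ?_ fun t _ _ => hg0 _ (hdin t)
        exact Finset.filter_subset_filter _
          (Finset.sdiff_subset.trans (Finset.erase_subset _ _))
    have hdiv : (T.card : ℝ) / L ≤ 20 * k := by
      rw [div_le_iff₀ (by rw [hL]; positivity), hL]
      push_cast
      calc (T.card : ℝ) ≤ ((80 * k ^ 2 : ℕ) : ℝ) := Nat.cast_le.2 hTk
        _ = 20 * k * (4 * k) := by push_cast; ring
    have hBn : B₁.card + B₂.card ≤ 2 * b + 40 * k := by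
      have : ((B₁.card + B₂.card : ℕ) : ℝ) ≤ ((2 * b + 40 * k : ℕ) : ℝ) := by
        push_cast
        linarith
      exact Nat.cast_le.1 this
    have h1 := Finset.le_card_sdiff (V₁ ∪ V₂ ∪ B₁ ∪ B₂) (T.erase u)
    have h2 := Finset.card_erase_add_one hu
    have h3 := Finset.card_union_le (V₁ ∪ V₂ ∪ B₁) B₂
    have h4 := Finset.card_union_le (V₁ ∪ V₂) B₁
    have h5 := Finset.card_union_le V₁ V₂
    omega
  · refine hQ₁.union ⟨?_, ?_⟩ ?_ ?_
    · intro p hp q hq hpq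
      have := hQ₂.snd_inj _ ((hQout p).1 hp) _ ((hQout q).1 hq) hpq
      simp only [Prod.mk.injEq] at this
      exact Prod.ext hpq this.1
    · intro p hp q hq hpq
      have := hQ₂.fst_inj _ ((hQout p).1 hp) _ ((hQout q).1 hq) hpq
      simp only [Prod.mk.injEq] at this
      exact Prod.ext this.2 hpq
    · exact fun p hp q hq h => (hn₂ q hq).1.2 (h ▸ (hm₁ p hp).1)
    · exact fun p hp q hq h => (hn₂ q hq).2.2 (h ▸ (hm₁ p hp).2)
  · exact Finset.disjoint_left.2 fun p hp hp' => (hn₂ p hp').1.2 (hm₁ p hp).1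
  · intro p hp
    have hout : ∀ z, z ∈ V₁ ∨ z ∈ V₂ → z ∉ T.erase u \ (V₁ ∪ V₂ ∪ B₁ ∪ B₂) := by
      intro z hz hz'
      simp only [Finset.mem_sdiff, Finset.mem_union] at hz'
      tauto
    rcases Finset.mem_union.1 hp with hp | hp
    · obtain ⟨h1, h2, h3⟩ := hQ₁R p hp
      have h1' := Finset.mem_erase.1 (Finset.mem_filter.1 h1).1
      have h2' := Finset.mem_erase.1 h2
      exact ⟨⟨h1'.2, hout _ (Or.inl (hm₁ p hp).1), h1'.1⟩,
        ⟨h2'.2, hout _ (Or.inl (hm₁ p hp).2), h2'.1⟩, h3⟩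
    · have h1' := Finset.mem_erase.1 (hn₂ p hp).1.1
      have h2' := Finset.mem_erase.1 (hn₂ p hp).2.1
      exact ⟨⟨h1'.2, hout _ (Or.inr (hm₂ p hp).1), h1'.1⟩,
        ⟨h2'.2, hout _ (Or.inr (hm₂ p hp).2), h2'.1⟩, (hQ₂R _ ((hQout p).1 hp)).2.2⟩
  · intro t ht hK
    simp only [Finset.mem_sdiff, Finset.mem_union, not_or] at ht
    have hB := ht.2.1.2
    by_contra hcon
    refine hB (Finset.mem_filter.2 ⟨Finset.mem_filter.2 ⟨ht.1, hK⟩, fun p hp hKp => ?_⟩)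
    exact hcon ⟨p, hp, (Finset.mem_filter.1 (hQ₁R p hp).1).2, hKp⟩
  · intro t ht hK
    simp only [Finset.mem_sdiff, Finset.mem_union, not_or] at ht
    have hB := ht.2.2
    by_contra hcon
    refine hB (Finset.mem_filter.2 ⟨Finset.mem_filter.2
      ⟨Finset.mem_sdiff.2 ⟨ht.1, ht.2.1.1.1⟩, hK⟩, fun p hp hKp => ?_⟩)
    exact hcon ⟨(p.2, p.1), (hQout _).2 hp, hKp, (Finset.mem_filter.1 (hQ₂R p hp).1).2⟩

/-- From `80 * k ^ 2` indices one can choose `k` indices `U` and a labelled matching `Q` in `K` on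
other indices such that every pair `K t u` with distinct `t, u ∈ U` is served by some
`(s, r) ∈ Q`, that is, `K s u` and `K t r`, and the label of `(s, r)` is either `u` on the left or
`t` on the right. -/
theorem exists_served_subset (K : ι → ι → Prop) {T₀ : Finset ι} {k : ℕ} (hk : 0 < k)
    (hT₀ : T₀.card = 80 * k ^ 2) :
    ∃ (U : Finset ι) (Q : Finset (ι × ι)) (lab : ι × ι → ι ⊕ ι), U ⊆ T₀ ∧ U.card = k ∧
      IsPairMatching Q ∧ (∀ p ∈ Q, (p.1 ∈ T₀ ∧ p.1 ∉ U) ∧ (p.2 ∈ T₀ ∧ p.2 ∉ U) ∧ K p.1 p.2) ∧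
      ∀ u ∈ U, ∀ t ∈ U, t ≠ u → K t u →
        ∃ p ∈ Q, K p.1 u ∧ K t p.2 ∧ (lab p = Sum.inl u ∨ lab p = Sum.inr t) := by
  let Served (Q : Finset (ι × ι)) (lab : ι × ι → ι ⊕ ι) (t u : ι) : Prop :=
    ∃ p ∈ Q, K p.1 u ∧ K t p.2 ∧ (lab p = Sum.inl u ∨ lab p = Sum.inr t)
  -- The indices of `U` are chosen one by one; all pairs between `U` and the current pool `T`
  -- are kept served.
  have key : ∀ j ≤ k, ∃ (U T : Finset ι) (Q : Finset (ι × ι)) (lab : ι × ι → ι ⊕ ι),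
      U ⊆ T₀ ∧ T ⊆ T₀ ∧ U.card = j ∧ 80 * k ^ 2 ≤ T.card + 75 * k * j ∧ Disjoint U T ∧
      IsPairMatching Q ∧ (∀ p ∈ Q, (p.1 ∈ T₀ ∧ p.1 ∉ U ∧ p.1 ∉ T) ∧
        (p.2 ∈ T₀ ∧ p.2 ∉ U ∧ p.2 ∉ T) ∧ K p.1 p.2) ∧
      ∀ u ∈ U, ∀ t ∈ U ∪ T, t ≠ u →
        (K t u → Served Q lab t u) ∧ (K u t → Served Q lab u t) := by
    intro j
    induction j with
    | zero =>
      exact fun _ => ⟨∅, T₀, ∅, Sum.inl ∘ Prod.fst, by simp, subset_rfl, by simp, by simp [hT₀],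
        by simp, IsPairMatching.empty, by simp, by simp⟩
    | succ j ih =>
      intro hj
      obtain ⟨U, T, Q, lab, hU, hT, hUc, hTc, hUT, hQ, hQR, hserv⟩ := ih (by omega)
      have hTne : T.Nonempty := by
        rw [← Finset.card_pos]
        have : 75 * k * j ≤ 75 * k * k := Nat.mul_le_mul_left _ (by omega)
        nlinarith
      obtain ⟨u, hu, Qin, Qout, T', hT', hT'c, huT', hQ', hdisj, hQ'R, hin, hout⟩ :=
        exists_index_served K hTne hk (hT₀ ▸ Finset.card_le_card hT)
      have huU : u ∉ U := fun h => Finset.disjoint_left.1 hUT h hu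
      let lab' : ι × ι → ι ⊕ ι := fun p =>
        if p ∈ Qin then Sum.inl u else if p ∈ Qout then Sum.inr u else lab p
      have hQQ' : ∀ p ∈ Q, p ∉ Qin ∧ p ∉ Qout := fun p hp =>
        ⟨fun h => (hQR p hp).1.2.2 (hQ'R p (Finset.mem_union_left _ h)).1.1,
          fun h => (hQR p hp).1.2.2 (hQ'R p (Finset.mem_union_right _ h)).1.1⟩
      have hmono : ∀ t v, Served Q lab t v → Served (Q ∪ (Qin ∪ Qout)) lab' t v := by
        rintro t v ⟨p, hp, h1, h2, h3⟩
        refine ⟨p, Finset.mem_union_left _ hp, h1, h2, ?_⟩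
        simpa only [lab', (hQQ' p hp).1, (hQQ' p hp).2, if_false] using h3
      refine ⟨insert u U, T', Q ∪ (Qin ∪ Qout), lab', ?_, hT'.trans hT, ?_, ?_, ?_, ?_, ?_, ?_⟩
      · exact Finset.insert_subset (hT hu) hU
      · rw [Finset.card_insert_of_notMem huU, hUc]
      · rw [mul_add]
        omega
      · exact Finset.disjoint_insert_left.2 ⟨huT', hUT.mono_right hT'⟩
      · exact hQ.union hQ' (fun p hp q hq h => (hQR p hp).1.2.2 (h ▸ (hQ'R q hq).1.1))
          fun p hp q hq h => (hQR p hp).2.1.2.2 (h ▸ (hQ'R q hq).2.1.1)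
      · intro p hp
        simp only [Finset.mem_insert, not_or]
        rcases Finset.mem_union.1 hp with hp | hp
        · obtain ⟨⟨h1, h2, h3⟩, ⟨h4, h5, h6⟩, h7⟩ := hQR p hp
          exact ⟨⟨h1, ⟨fun h => h3 (h ▸ hu), h2⟩, fun h => h3 (hT' h)⟩,
            ⟨h4, ⟨fun h => h6 (h ▸ hu), h5⟩, fun h => h6 (hT' h)⟩, h7⟩
        · obtain ⟨⟨h1, h2, h3⟩, ⟨h4, h5, h6⟩, h7⟩ := hQ'R p hp
          exact ⟨⟨hT h1, ⟨h3, fun h => Finset.disjoint_left.1 hUT h h1⟩, h2⟩,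
            ⟨hT h4, ⟨h6, fun h => Finset.disjoint_left.1 hUT h h4⟩, h5⟩, h7⟩
      · intro v hv t ht htv
        simp only [Finset.mem_union, Finset.mem_insert] at ht
        rcases Finset.mem_insert.1 hv with rfl | hv
        · rcases ht with (ht | ht) | ht
          · exact absurd ht htv
          · have := hserv t ht v (Finset.mem_union_right _ hu) htv.symm
            exact ⟨fun h => hmono _ _ (this.2 h), fun h => hmono _ _ (this.1 h)⟩
          · refine ⟨fun h => ?_, fun h => ?_⟩
            · obtain ⟨p, hp, h1, h2⟩ := hin t ht h
              refine ⟨p, Finset.mem_union_right _ (Finset.mem_union_left _ hp), h1, h2,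
                Or.inl ?_⟩
              simp only [lab', hp, if_true]
            · obtain ⟨p, hp, h1, h2⟩ := hout t ht h
              refine ⟨p, Finset.mem_union_right _ (Finset.mem_union_right _ hp), h1, h2,
                Or.inr ?_⟩
              simp only [lab', hp, Finset.disjoint_right.1 hdisj hp, if_true, if_false]
        · have htm : t ∈ U ∪ T := by
            rcases ht with (rfl | ht) | ht
            · exact Finset.mem_union_right _ hu
            · exact Finset.mem_union_left _ ht
            · exact Finset.mem_union_right _ (hT' ht)
          have := hserv v hv t htm htv
          exact ⟨fun h => hmono _ _ (this.1 h), fun h => hmono _ _ (this.2 h)⟩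
  obtain ⟨U, T, Q, lab, hU, -, hUc, -, -, hQ, hQR, hserv⟩ := key k le_rfl
  refine ⟨U, Q, lab, hU, hUc, hQ, fun p hp => ?_, fun u hu t ht htu h => ?_⟩
  · obtain ⟨⟨h1, h2, h3⟩, ⟨h4, h5, h6⟩, h7⟩ := hQR p hp
    exact ⟨⟨h1, h2⟩, ⟨h4, h5⟩, h7⟩
  · exact (hserv u hu t (Finset.mem_union_left _ ht) htu).1 h

end Conflicts

/-! ### Standard examples in two antichains -/

section StandardExample

variable {P : Type*} [PartialOrder P] {ι : Type*} {x y : ι → P}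

/-- Indices without comparability failures besides the pairs `x i, y i` span a standard example. -/
theorem IncomparablePairs.containsPoset (hxy : IncomparablePairs x y) {J : Finset ι}
    (hJ : ∀ i ∈ J, ∀ j ∈ J, i ≠ j → x i ≤ y j) : ContainsPoset P (StandardExample J.card) := by
  let φ : Fin J.card → ι := fun i => J.equivFin.symm i
  have hφ : ∀ i, φ i ∈ J := fun i => (J.equivFin.symm i).2
  have hφi : ∀ i j, φ i = φ j → i = j := fun i j h =>
    J.equivFin.symm.injective (Subtype.ext h)
  let F : StandardExample J.card → P := fun z => match z with
    | .a i => x (φ i)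
    | .b i => y (φ i)
  have hle : ∀ z w, F z ≤ F w ↔ z ≤ w := by
    intro z w
    constructor
    · intro h
      cases z with
      | a i =>
        cases w with
        | a j => rw [hφi i j (hxy.le_fst _ _ h)]
        | b j =>
          refine StandardExample.Le.a_le_b ?_
          rintro rfl
          exact hxy.not_fst_le_snd _ h
      | b i =>
        cases w with
        | a j => exact absurd h (hxy.not_snd_le_fst _ _)
        | b j => rw [hφi i j (hxy.le_snd _ _ h)]
    · intro h
      cases h with
      | refl => exact le_rfl
      | a_le_b h => exact hJ _ (hφ _) _ (hφ _) fun h' => h (hφi _ _ h')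
  exact ⟨OrderEmbedding.ofMapLEIff F hle⟩

variable [Fintype P] [Fintype ι] {n e ρ : ℕ}

/-- Only the pairs `x i, y j` cost more than a bounded number of linear extensions. -/
theorem ResistsCovers.le_of_covers (h : ResistsCovers P n e) (hxy : IncomparablePairs x y)
    (hρ : (Finset.univ.image x ∪ Finset.univ.image y)ᶜ.card ≤ ρ) {q : ℕ}
    (hq : Covers (fun z w => (∃ i, z = x i) ∧ (∃ j, w = y j) ∧ ¬ z ≤ w) q) :
    n ≤ q + (5 + 2 * ρ + e) := by
  have hX : IsAntichain (· ≤ ·) ((Finset.univ.image x : Finset P) : Set P) := by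
    intro z hz w hw hne hle
    obtain ⟨i, -, rfl⟩ := Finset.mem_image.1 (Finset.mem_coe.1 hz)
    obtain ⟨j, -, rfl⟩ := Finset.mem_image.1 (Finset.mem_coe.1 hw)
    exact hne (congrArg x (hxy.le_fst i j hle))
  have hY : IsAntichain (· ≤ ·) ((Finset.univ.image y : Finset P) : Set P) := by
    intro z hz w hw hne hle
    obtain ⟨i, -, rfl⟩ := Finset.mem_image.1 (Finset.mem_coe.1 hz)
    obtain ⟨j, -, rfl⟩ := Finset.mem_image.1 (Finset.mem_coe.1 hw)
    exact hne (congrArg y (hxy.le_snd i j hle))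
  have hlevel : Covers (fun z w => z ∈ Finset.univ.image y ∧ w ∈ Finset.univ.image x) 1 := by
    refine Covers.raise_set fun z hz w hw => ?_
    obtain ⟨i, -, rfl⟩ := Finset.mem_image.1 hz
    obtain ⟨j, -, rfl⟩ := Finset.mem_image.1 hw
    exact hxy.not_snd_le_fst i j
  have := h _ _ ((((hq.or (Covers.antichain hX)).or (Covers.antichain hY)).or hlevel).mono
    (W' := fun z w => z ∈ Finset.univ.image x ∪ Finset.univ.image y ∧
      w ∈ Finset.univ.image x ∪ Finset.univ.image y ∧ ¬ z ≤ w) (by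
      rintro z w ⟨hz, hw, hzw⟩
      simp only [Finset.mem_union] at hz hw
      have hz' : z ∈ Finset.univ.image x → ∃ i, z = x i := fun h => by
        obtain ⟨i, -, rfl⟩ := Finset.mem_image.1 h
        exact ⟨i, rfl⟩
      have hw' : w ∈ Finset.univ.image y → ∃ i, w = y i := fun h => by
        obtain ⟨i, -, rfl⟩ := Finset.mem_image.1 h
        exact ⟨i, rfl⟩
      tauto) le_rfl)
  omega

/-- Every maximal matching of incomparable pairs `x i, y j` leaves few indices unmatched: raise
`x i` and lower `y j` for each of its pairs. -/
theorem ResistsCovers.le_card_maximal_matching (h : ResistsCovers P n e)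
    (hxy : IncomparablePairs x y)
    (hρ : (Finset.univ.image x ∪ Finset.univ.image y)ᶜ.card ≤ ρ) {M : Finset (ι × ι)}
    (hME : ∀ p ∈ M, ¬ x p.1 ≤ y p.2)
    (hmax : ∀ i j, (∀ p ∈ M, p.1 ≠ i) → (∀ p ∈ M, p.2 ≠ j) → x i ≤ y j) :
    n ≤ M.card + (5 + 2 * ρ + e) := by
  refine h.le_of_covers hxy hρ
    ((Covers.biUnion M _ fun p hp => Covers.raise_lower (hME p hp)).mono ?_ le_rfl)
  rintro z w ⟨⟨i, rfl⟩, ⟨j, rfl⟩, hij⟩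
  by_cases hi : ∃ p ∈ M, p.1 = i
  · obtain ⟨p, hp, rfl⟩ := hi
    exact ⟨p, hp, Or.inl ⟨rfl, hij⟩⟩
  · by_cases hj : ∃ p ∈ M, p.2 = j
    · obtain ⟨p, hp, rfl⟩ := hj
      exact ⟨p, hp, Or.inr ⟨rfl, hij⟩⟩
    · push Not at hi hj
      exact absurd (hmax i j hi hj) hij

/-- Disjoint arcs `i ⟶ j`, with `x i, y j` incomparable, are few: for an arc `t = (i, j)` a single
linear extension raises `x i`, lowers `y j`, and then puts `x j` above `y i`. This saves one linear
extension over the two pairs `x i, y i` and `x j, y j`, except that the pairs `x j, y i'` of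
different arcs must be served otherwise. Many arcs have a subset of size `k` for which this is done
by pairs of a matching between the remaining points. -/
theorem ResistsCovers.card_arcs_lt (h : ResistsCovers P n e)
    (hcard : Fintype.card P ≤ 2 * n + 1) (hxy : IncomparablePairs x y)
    (hρ : (Finset.univ.image x ∪ Finset.univ.image y)ᶜ.card ≤ ρ) {F : Finset (ι × ι)}
    (hF : IsPairMatching F) (hdisj : ∀ p ∈ F, ∀ q ∈ F, p.1 ≠ q.2)
    (hFE : ∀ p ∈ F, ¬ x p.1 ≤ y p.2) :
    F.card < 80 * (3 * (5 + 2 * ρ + e) + 1) ^ 2 := by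
  by_contra! hlarge
  obtain ⟨v, hv⟩ : ∃ v, v = 5 + 2 * ρ + e := ⟨_, rfl⟩
  obtain ⟨k, hk⟩ : ∃ k, k = 3 * v + 1 := ⟨_, rfl⟩
  rw [← hv, ← hk] at hlarge
  obtain ⟨T₀, hT₀F, hT₀⟩ := Finset.exists_subset_card_eq hlarge
  obtain ⟨U, Q, lab, hU, hUc, hQ, hQR, hserv⟩ := exists_served_subset
    (fun s t : ι × ι => ¬ x s.2 ≤ y t.1) (by omega) hT₀
  have hUF : U ⊆ F := hU.trans hT₀F
  have hQF : ∀ p ∈ Q, p.1 ∈ F ∧ p.2 ∈ F := fun p hp =>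
    ⟨hT₀F (hQR p hp).1.1, hT₀F (hQR p hp).2.1.1⟩
  -- The pairs of `Q` together with `x i, y i` and `x j, y j`, for the arcs `(i, j)` of `U`, extend
  -- to a maximal matching `M`.
  let QE : Finset (ι × ι) := Q.image fun p => (p.1.2, p.2.1)
  let UE : Finset (ι × ι) := U.image fun t => (t.1, t.1)
  let UE' : Finset (ι × ι) := U.image fun t => (t.2, t.2)
  have hQE : IsPairMatching QE ∧ QE.card = Q.card := by
    have h1 : ∀ p ∈ Q, ∀ q ∈ Q, p.1.2 = q.1.2 → p = q := fun p hp q hq hpq =>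
      hQ.fst_inj p hp q hq (hF.snd_inj _ (hQF p hp).1 _ (hQF q hq).1 hpq)
    have h2 : ∀ p ∈ Q, ∀ q ∈ Q, p.2.1 = q.2.1 → p = q := fun p hp q hq hpq =>
      hQ.snd_inj p hp q hq (hF.fst_inj _ (hQF p hp).2 _ (hQF q hq).2 hpq)
    refine ⟨⟨?_, ?_⟩, Finset.card_image_of_injOn fun p hp q hq hpq =>
      h1 p hp q hq (Prod.ext_iff.1 hpq).1⟩
    · intro a ha b hb hab
      obtain ⟨p, hp, rfl⟩ := Finset.mem_image.1 ha
      obtain ⟨q, hq, rfl⟩ := Finset.mem_image.1 hb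
      rw [h1 p hp q hq hab]
    · intro a ha b hb hab
      obtain ⟨p, hp, rfl⟩ := Finset.mem_image.1 ha
      obtain ⟨q, hq, rfl⟩ := Finset.mem_image.1 hb
      rw [h2 p hp q hq hab]
  have hUE : IsPairMatching UE ∧ UE.card = k := by
    have h1 : ∀ p ∈ U, ∀ q ∈ U, p.1 = q.1 → p = q := fun p hp q hq hpq =>
      hF.fst_inj _ (hUF hp) _ (hUF hq) hpq
    have h2 : UE.card = U.card := Finset.card_image_of_injOn fun p hp q hq hpq =>
      h1 p hp q hq (Prod.ext_iff.1 hpq).1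
    refine ⟨⟨?_, ?_⟩, h2.trans hUc⟩ <;>
    · intro a ha b hb hab
      obtain ⟨p, hp, rfl⟩ := Finset.mem_image.1 ha
      obtain ⟨q, hq, rfl⟩ := Finset.mem_image.1 hb
      rw [h1 p hp q hq hab]
  have hUE' : IsPairMatching UE' ∧ UE'.card = k := by
    have h1 : ∀ p ∈ U, ∀ q ∈ U, p.2 = q.2 → p = q := fun p hp q hq hpq =>
      hF.snd_inj _ (hUF hp) _ (hUF hq) hpq
    have h2 : UE'.card = U.card := Finset.card_image_of_injOn fun p hp q hq hpq =>
      h1 p hp q hq (Prod.ext_iff.1 hpq).1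
    refine ⟨⟨?_, ?_⟩, h2.trans hUc⟩ <;>
    · intro a ha b hb hab
      obtain ⟨p, hp, rfl⟩ := Finset.mem_image.1 ha
      obtain ⟨q, hq, rfl⟩ := Finset.mem_image.1 hb
      rw [h1 p hp q hq hab]
  have hne : ∀ a ∈ UE, ∀ b ∈ UE', a.1 ≠ b.1 ∧ a.2 ≠ b.2 := by
    intro a ha b hb
    obtain ⟨p, hp, rfl⟩ := Finset.mem_image.1 ha
    obtain ⟨q, hq, rfl⟩ := Finset.mem_image.1 hb
    exact ⟨hdisj p (hUF hp) q (hUF hq), hdisj p (hUF hp) q (hUF hq)⟩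
  have hne' : ∀ a ∈ QE, ∀ b ∈ UE ∪ UE', a.1 ≠ b.1 ∧ a.2 ≠ b.2 := by
    intro a ha b hb
    obtain ⟨p, hp, rfl⟩ := Finset.mem_image.1 ha
    obtain ⟨h1, h2⟩ := hQF p hp
    obtain ⟨⟨-, h3⟩, ⟨-, h4⟩, -⟩ := hQR p hp
    rcases Finset.mem_union.1 hb with hb | hb
    · obtain ⟨q, hq, rfl⟩ := Finset.mem_image.1 hb
      refine ⟨(hdisj q (hUF hq) _ h1).symm, fun heq => h4 ?_⟩
      rw [hF.fst_inj _ h2 _ (hUF hq) heq]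
      exact hq
    · obtain ⟨q, hq, rfl⟩ := Finset.mem_image.1 hb
      refine ⟨fun heq => h3 ?_, hdisj _ h2 q (hUF hq)⟩
      rw [hF.snd_inj _ h1 _ (hUF hq) heq]
      exact hq
  have hUU := hUE.1.union hUE'.1 (fun a ha b hb => (hne a ha b hb).1)
    fun a ha b hb => (hne a ha b hb).2
  have hB := hQE.1.union hUU (fun a ha b hb => (hne' a ha b hb).1)
    fun a ha b hb => (hne' a ha b hb).2
  have hBc : (QE ∪ (UE ∪ UE')).card = Q.card + (k + k) := by
    rw [Finset.card_union_of_disjoint, Finset.card_union_of_disjoint, hQE.2, hUE.2, hUE'.2]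
    · exact Finset.disjoint_left.2 fun a ha hb => (hne a ha a hb).1 rfl
    · exact Finset.disjoint_left.2 fun a ha hb => (hne' a ha a hb).1 rfl
  obtain ⟨M, hBM, hM, hMR, hmax⟩ := exists_maximal_matching (fun i j => ¬ x i ≤ y j)
    (Finset.univ : Finset ι) (Finset.univ : Finset ι) _ hB (by
      intro a ha
      refine ⟨Finset.mem_univ _, Finset.mem_univ _, ?_⟩
      rcases Finset.mem_union.1 ha with ha | ha
      · obtain ⟨p, hp, rfl⟩ := Finset.mem_image.1 ha
        exact (hQR p hp).2.2
      · rcases Finset.mem_union.1 ha with ha | ha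
        · obtain ⟨p, hp, rfl⟩ := Finset.mem_image.1 ha
          exact hxy.not_fst_le_snd _
        · obtain ⟨p, hp, rfl⟩ := Finset.mem_image.1 ha
          exact hxy.not_fst_le_snd _)
  have hMc := h.le_card_maximal_matching hxy hρ (fun p hp => (hMR p hp).2.2)
    fun i j hi hj => not_not.1 (hmax i (Finset.mem_univ _) j (Finset.mem_univ _) hi hj)
  -- The linear extensions for the pairs of `Q`, with a third task given by the label.
  have hcovQ := Covers.biUnion Q (fun p z w => (z = x p.1.2 ∧ ¬ z ≤ w) ∨ (w = y p.2.1 ∧ ¬ z ≤ w) ∨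
      (∃ u, lab p = Sum.inl u ∧ ¬ x p.1.2 ≤ y u.1 ∧ w = y u.1 ∧ ¬ z ≤ y p.2.1 ∧ ¬ z ≤ w) ∨
      ∃ t, lab p = Sum.inr t ∧ ¬ x t.2 ≤ y p.2.1 ∧ z = x t.2 ∧ ¬ x p.1.2 ≤ w ∧ ¬ z ≤ w) (by
    intro p hp
    have hpE := (hQR p hp).2.2
    rcases hl : lab p with u | t
    · by_cases hE : x p.1.2 ≤ y u.1
      · refine (Covers.raise_lower hpE).mono ?_ le_rfl
        rintro z w (⟨rfl, hzw⟩ | ⟨rfl, hzw⟩ | ⟨u', hu', hE', -⟩ | ⟨t', ht', -⟩)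
        · exact Or.inl ⟨rfl, hzw⟩
        · exact Or.inr ⟨rfl, hzw⟩
        · obtain rfl := Sum.inl.inj hu'
          exact absurd hE hE'
        · simp at ht'
      · refine (Covers.raise_lower_lower hpE hE).mono ?_ le_rfl
        rintro z w (⟨rfl, hzw⟩ | ⟨rfl, hzw⟩ | ⟨u', hu', -, rfl, hzr, hzw⟩ | ⟨t', ht', -⟩)
        · exact Or.inl ⟨rfl, hzw⟩
        · exact Or.inr (Or.inl ⟨rfl, hzw⟩)
        · obtain rfl := Sum.inl.inj hu'
          exact Or.inr (Or.inr ⟨rfl, hzr, hzw⟩)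
        · simp at ht'
    · by_cases hE : x t.2 ≤ y p.2.1
      · refine (Covers.raise_lower hpE).mono ?_ le_rfl
        rintro z w (⟨rfl, hzw⟩ | ⟨rfl, hzw⟩ | ⟨u', hu', -⟩ | ⟨t', ht', hE', -⟩)
        · exact Or.inl ⟨rfl, hzw⟩
        · exact Or.inr ⟨rfl, hzw⟩
        · simp at hu'
        · obtain rfl := Sum.inr.inj ht'
          exact absurd hE hE'
      · refine (Covers.raise_lower_raise hpE hE).mono ?_ le_rfl
        rintro z w (⟨rfl, hzw⟩ | ⟨rfl, hzw⟩ | ⟨u', hu', -⟩ | ⟨t', ht', -, rfl, hzr, hzw⟩)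
        · exact Or.inl ⟨rfl, hzw⟩
        · exact Or.inr (Or.inl ⟨rfl, hzw⟩)
        · simp at hu'
        · obtain rfl := Sum.inr.inj ht'
          exact Or.inr (Or.inr ⟨rfl, hzr, hzw⟩))
  have hcovU := Covers.biUnion U _ fun t ht =>
    Covers.raise_lower_raise (hFE t (hUF ht)) (hxy.not_fst_le_snd t.2)
  have hcov := (((hcovQ.or hcovU).or (Covers.biUnion (M \ (QE ∪ (UE ∪ UE'))) _ fun p hp =>
    Covers.raise_lower (hMR p (Finset.mem_sdiff.1 hp).1).2.2)).or
    (Covers.biUnion (Finset.univ \ M.image Prod.fst) _ fun i _ => Covers.raise (x i))).or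
    (Covers.biUnion (Finset.univ \ M.image Prod.snd) _ fun j _ => Covers.lower (y j))
  have hmain := h.le_of_covers hxy hρ (hcov.mono ?_ le_rfl)
  · have h1 := Finset.card_sdiff_add_card_eq_card hBM
    have h2 := Finset.card_sdiff_add_card_eq_card (Finset.subset_univ (M.image Prod.fst))
    have h3 := Finset.card_sdiff_add_card_eq_card (Finset.subset_univ (M.image Prod.snd))
    have h4 := Finset.card_le_univ (Finset.univ.image x ∪ Finset.univ.image y)
    rw [hM.card_image_fst, Finset.card_univ] at h2
    rw [hM.card_image_snd, Finset.card_univ] at h3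
    rw [hxy.card_union] at h4
    omega
  · rintro z w ⟨⟨i, rfl⟩, ⟨j, rfl⟩, hij⟩
    by_cases hi : i ∉ U.image Prod.snd
    · by_cases hiM : i ∈ M.image Prod.fst
      · obtain ⟨p, hp, rfl⟩ := Finset.mem_image.1 hiM
        by_cases hpB : p ∈ QE ∪ (UE ∪ UE')
        · rcases Finset.mem_union.1 hpB with hpB | hpB
          · obtain ⟨q, hq, rfl⟩ := Finset.mem_image.1 hpB
            exact Or.inl (Or.inl (Or.inl (Or.inl ⟨q, hq, Or.inl ⟨rfl, hij⟩⟩)))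
          · rcases Finset.mem_union.1 hpB with hpB | hpB
            · obtain ⟨q, hq, rfl⟩ := Finset.mem_image.1 hpB
              exact Or.inl (Or.inl (Or.inl (Or.inr ⟨q, hq, Or.inl ⟨rfl, hij⟩⟩)))
            · obtain ⟨q, hq, rfl⟩ := Finset.mem_image.1 hpB
              exact absurd (Finset.mem_image_of_mem Prod.snd hq) hi
        · exact Or.inl (Or.inl (Or.inr ⟨p, Finset.mem_sdiff.2 ⟨hp, hpB⟩, Or.inl ⟨rfl, hij⟩⟩))
      · exact Or.inl (Or.inr ⟨i, Finset.mem_sdiff.2 ⟨Finset.mem_univ _, hiM⟩, rfl, hij⟩)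
    rw [not_not] at hi
    by_cases hj : j ∈ U.image Prod.fst
    · obtain ⟨t, ht, rfl⟩ := Finset.mem_image.1 hi
      obtain ⟨u, hu, rfl⟩ := Finset.mem_image.1 hj
      by_cases htu : t = u
      · subst htu
        exact Or.inl (Or.inl (Or.inl (Or.inr ⟨t, ht, Or.inr (Or.inr
          ⟨rfl, hxy.not_fst_le_snd _, hij⟩)⟩)))
      · obtain ⟨p, hp, h1, h2, hl | hl⟩ := hserv u hu t ht htu hij
        · exact Or.inl (Or.inl (Or.inl (Or.inl ⟨p, hp, Or.inr (Or.inr (Or.inl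
            ⟨u, hl, h1, rfl, h2, hij⟩))⟩)))
        · exact Or.inl (Or.inl (Or.inl (Or.inl ⟨p, hp, Or.inr (Or.inr (Or.inr
            ⟨t, hl, h2, rfl, h1, hij⟩))⟩)))
    · by_cases hjM : j ∈ M.image Prod.snd
      · obtain ⟨p, hp, rfl⟩ := Finset.mem_image.1 hjM
        by_cases hpB : p ∈ QE ∪ (UE ∪ UE')
        · rcases Finset.mem_union.1 hpB with hpB | hpB
          · obtain ⟨q, hq, rfl⟩ := Finset.mem_image.1 hpB
            exact Or.inl (Or.inl (Or.inl (Or.inl ⟨q, hq, Or.inr (Or.inl ⟨rfl, hij⟩)⟩)))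
          · rcases Finset.mem_union.1 hpB with hpB | hpB
            · obtain ⟨q, hq, rfl⟩ := Finset.mem_image.1 hpB
              exact absurd (Finset.mem_image_of_mem Prod.fst hq) hj
            · obtain ⟨q, hq, rfl⟩ := Finset.mem_image.1 hpB
              exact Or.inl (Or.inl (Or.inl (Or.inr ⟨q, hq, Or.inr (Or.inl ⟨rfl, hij⟩)⟩)))
        · exact Or.inl (Or.inl (Or.inr ⟨p, Finset.mem_sdiff.2 ⟨hp, hpB⟩, Or.inr ⟨rfl, hij⟩⟩))
      · exact Or.inr ⟨j, Finset.mem_sdiff.2 ⟨Finset.mem_univ _, hjM⟩, rfl, hij⟩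

/-- A maximal family of disjoint arcs is small, and the indices it does not touch span a standard
example. -/
theorem ResistsCovers.exists_standardExample (h : ResistsCovers P n e)
    (hcard : Fintype.card P ≤ 2 * n + 1) (hxy : IncomparablePairs x y)
    (hρ : (Finset.univ.image x ∪ Finset.univ.image y)ᶜ.card ≤ ρ) :
    ∃ d, n ≤ d + (5 + 2 * ρ + e) + 160 * (3 * (5 + 2 * ρ + e) + 1) ^ 2 ∧
      ContainsPoset P (StandardExample d) := by
  obtain ⟨F, hFmem, hFmax⟩ := ((Finset.univ : Finset (Finset (ι × ι))).filter fun F =>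
    IsPairMatching F ∧ (∀ p ∈ F, ∀ q ∈ F, p.1 ≠ q.2) ∧
      ∀ p ∈ F, ¬ x p.1 ≤ y p.2).exists_max_image Finset.card
    ⟨∅, Finset.mem_filter.2 ⟨Finset.mem_univ _, IsPairMatching.empty, by simp, by simp⟩⟩
  obtain ⟨-, hF, hdisj, hFE⟩ := Finset.mem_filter.1 hFmem
  have hFc := h.card_arcs_lt hcard hxy hρ hF hdisj hFE
  obtain ⟨M, -, hM, hMR, hmax⟩ := exists_maximal_matching (fun i j => ¬ x i ≤ y j)
    (Finset.univ : Finset ι) (Finset.univ : Finset ι) ∅ IsPairMatching.empty (by simp)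
  have hMc := h.le_card_maximal_matching hxy hρ (fun p hp => (hMR p hp).2.2)
    fun i j hi hj => not_not.1 (hmax i (Finset.mem_univ _) j (Finset.mem_univ _) hi hj)
  have hMι : M.card ≤ Fintype.card ι := by
    rw [← hM.card_image_fst]
    exact Finset.card_le_univ _
  let J : Finset ι := Finset.univ \ (F.image Prod.fst ∪ F.image Prod.snd)
  have hJ : ∀ i ∈ J, (∀ p ∈ F, p.1 ≠ i) ∧ ∀ p ∈ F, p.2 ≠ i := by
    intro i hi
    simp only [J, Finset.mem_sdiff, Finset.mem_union, Finset.mem_image, not_or, not_exists,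
      not_and] at hi
    exact hi.2
  have hJc : Fintype.card ι ≤ J.card + 2 * F.card := by
    have h1 := Finset.le_card_sdiff (F.image Prod.fst ∪ F.image Prod.snd) (Finset.univ : Finset ι)
    have h2 := Finset.card_union_le (F.image Prod.fst) (F.image Prod.snd)
    rw [hF.card_image_fst, hF.card_image_snd] at h2
    rw [Finset.card_univ] at h1
    change _ ≤ J.card at h1
    omega
  refine ⟨J.card, by omega, hxy.containsPoset fun i hi j hj hne => ?_⟩
  by_contra hij
  have hnew := hFmax (insert (i, j) F) (Finset.mem_filter.2 ⟨Finset.mem_univ _,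
    hF.insert (hJ i hi).1 (hJ j hj).2, ?_, ?_⟩)
  · rw [Finset.card_insert_of_notMem fun hmem => (hJ i hi).1 _ hmem rfl] at hnew
    omega
  · intro p hp q hq
    rcases Finset.mem_insert.1 hp with rfl | hp <;> rcases Finset.mem_insert.1 hq with rfl | hq
    · exact hne
    · exact fun heq => (hJ i hi).2 q hq heq.symm
    · exact (hJ j hj).1 p hp
    · exact hdisj p hp q hq
  · intro p hp
    rcases Finset.mem_insert.1 hp with rfl | hp
    exacts [hij, hFE p hp]

end StandardExample

theorem theorem1p3 :
    ∃ f : ℕ → ℕ,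
      (fun c : ℕ => (f c : ℝ)) =O[atTop] (fun c : ℕ => (c : ℝ) ^ 2) ∧
      ∀ c : ℕ, 1 ≤ c → ∀ n : ℕ, 10 * f c < n →
        ∀ (P : Type*) [PartialOrder P] [Finite P],
          Nat.card P ≤ 2 * n + 1 →
          (n : ℤ) - (c : ℤ) ≤ (posetDim P : ℤ) →
          ∃ d : ℕ, 2 ≤ d ∧ (n : ℤ) - (f c : ℤ) ≤ (d : ℤ) ∧
            ContainsPoset P (StandardExample d) := by
  refine ⟨fun c => 10 ^ 12 * (c + 1) ^ 2, ?_, ?_⟩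
  · refine IsBigO.of_bound (4 * 10 ^ 12) ?_
    filter_upwards [eventually_ge_atTop 1] with c hc
    have hc' : (1 : ℝ) ≤ c := by exact_mod_cast hc
    rw [Real.norm_of_nonneg (by positivity), Real.norm_of_nonneg (by positivity)]
    push_cast
    nlinarith
  · intro c _ n hn P _ _ hcard hdim
    dsimp only at hn ⊢
    have := Fintype.ofFinite P
    rw [Nat.card_eq_fintype_card] at hcard
    have h := resistsCovers_of_posetDim hdim
    obtain ⟨J, x, y, hxy, hρ⟩ := h.exists_incomparablePairs (by omega) hcard
    obtain ⟨d, hd, hP⟩ := h.exists_standardExample hcard hxy hρ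
    have hbound : ∀ e : ℕ, 1 ≤ e → (5 + 2 * (10116 * e) + e) +
        160 * (3 * (5 + 2 * (10116 * e) + e) + 1) ^ 2 ≤ 10 ^ 12 * e ^ 2 := by
      intro e he
      have h1 : (3 * (5 + 2 * (10116 * e) + e) + 1) ^ 2 ≤ (60715 * e) ^ 2 :=
        Nat.pow_le_pow_left (by omega) 2
      nlinarith
    have hb := hbound (c + 1) (by omega)
    have hpos : 0 < (c + 1) ^ 2 := by positivity
    refine ⟨d, ?_, ?_, hP⟩
    · omega
    · push_cast
      zify at hb hd
      linarith
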